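/- Let $U\subseteq\mathbb C$ be a nonempty connected open set, and let $\mathfrak d^1_0(U)$ be the Lie algebra, under the commutator, of all operators $$T=f(z)\,\partial_z+g(z)\,\theta\partial_\theta+h(z),\qquad f,g,h \text{ analytic on } U,$$ acting on functions $u(z)+v(z)\theta$ of $z\in U$ and one Grassmann variable $\theta$ ($\theta^2=0$). Let $\mathfrak l\subset\mathfrak d^1_0(U)$ be a finite-dimensional complex Lie subalgebra. Call $p\in U$ regular if either $f=0$ for all $T\in\mathfrak l$, or $f(p)\neq0$ for some $T\in\mathfrak l$. Then the regular points are dense in $U$, and every regular point $p$ has an open neighbourhood $V\subseteq U$ on which $\mathfrak l$ is equivalent to one of the Lie algebras $\mathfrak l^0,\dots,\mathfrak l^3$ below. Here equivalence means that there are a biholomorphic map $\varphi$ of $V$ onto an open set $W\subseteq\mathbb C$ and non-vanishing analytic functions $\beta,\alpha$ on $V$ such that the change of variables $\bar z=\varphi(z)$, $\bar\theta=\beta(z)\theta$ followed by the gauge transformation $T\mapsto\alpha\,T\,\alpha^{-1}$ carries the restriction of $\mathfrak l$ to $V$ exactly onto the listed space of operators on $W$ (whose variables are again written $z,\theta$).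 Angle brackets denote complex linear spans. (i) $\mathfrak l^0=\langle g_i(z)\theta\partial_\theta+h_i(z)\mid 1\le i\le m\rangle$, $m\ge0$, where $g_i,h_i$ are analytic on $W$ and the operators are linearly independent. (ii) $\mathfrak l^1=\langle\partial_z\rangle+\mathfrak m(\mathfrak a_0,M)$, where $M\subset\mathbb C$ is finite and $\mathfrak m(\mathfrak a_0,M)$ is the finite-dimensional, $\mathrm{ad}\,\partial_z$-invariant space spanned, for $\mu\in M$, by $$z^k e^{\mu z}\theta\partial_\theta\ (0\le k\le m_\mu),\qquad z^k e^{\mu z}\ (0\le k\le n_\mu),\qquad e^{\mu z}\Big(z^{m_\mu+k}\theta\partial_\theta+z^{n_\mu}\sum_{j=1}^k c^{\mu,k}_j z^j\Big)\ (1\le k\le r_\mu),$$ with integers $m_\mu,n_\mu\ge-1$, $r_\mu\ge0$ and $$c^{\mu,k}_j=\frac{(m_\mu+k)!\,(n_\mu+1)!}{(n_\mu+j)!\,(m_\mu+k-j+1)!}\,c^{\mu,k-j+1},\qquad c^{\mu,1},\dots,c^{\mu,r_\mu}\in\mathbb C,\quad c^{\mu,1}\ne0 \text{ if } r_\mu\ge1.$$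 (iii) $\mathfrak l^2=\langle\partial_z,\ z\partial_z+\alpha\theta\partial_\theta+\beta\rangle+\mathfrak m_0(\mathfrak a_0)$ with $\alpha,\beta\in\mathbb C$, where $$\mathfrak m_0(\mathfrak a_0)=\langle z^i\theta\partial_\theta,\ z^j,\ z^k(z^m\theta\partial_\theta+c_kz^n)\mid 0\le i\le m,\ 0\le j\le n,\ 1\le k\le r\rangle,\qquad c_k=\frac{(m+k)!\,(n+1)!}{(n+k)!\,(m+1)!}\,c,$$ with integers $m,n\ge-1$, $r\ge0$ and a complex number $c\neq0$, and with $m=n$ if $r\ge1$. (iv) $\mathfrak l^3$ is spanned by $\partial_z$, $z\partial_z+\alpha\theta\partial_\theta+\beta$, $z^2\partial_z+2\alpha z\theta\partial_\theta+2\beta z$ and a (possibly empty) subset of $\{\theta\partial_\theta+\gamma,\ 1\}$, with $\alpha,\beta,\gamma\in\mathbb C$. -/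

import Mathlib

open TopologicalSpace

noncomputable section

namespace EvenOps

/-- Extension by zero of a function on an open set; only its values on `U` matter. -/
def ext0 {U : Opens ℂ} (f : U → ℂ) : ℂ → ℂ := Function.extend Subtype.val f 0

theorem ext0_apply {U : Opens ℂ} (f : U → ℂ) (z : U) : ext0 f z = f z :=
  Subtype.val_injective.extend_apply f 0 z

theorem ext0_eventuallyEq {U : Opens ℂ} (f : U → ℂ) (F : ℂ → ℂ) (h : ∀ z : U, f z = F z)
    (z : U) : F =ᶠ[nhds (z : ℂ)] ext0 f := by
  filter_upwards [U.isOpen.mem_nhds z.2] with w hw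
  rw [ext0_apply f ⟨w, hw⟩, h]

/-- A function on `U` which agrees on `U` with a function analytic at each point of `U`
is analytic. -/
theorem analyticOnNhd_ext0 {U : Opens ℂ} {f : U → ℂ} {F : ℂ → ℂ}
    (hF : AnalyticOnNhd ℂ F U) (h : ∀ z : U, f z = F z) : AnalyticOnNhd ℂ (ext0 f) U :=
  fun z hz => (hF z hz).congr (ext0_eventuallyEq f F h ⟨z, hz⟩)

/-- The algebra of analytic functions on the open set `U ⊆ ℂ`. -/
def Hol (U : Opens ℂ) : Subalgebra ℂ (U → ℂ) where
  carrier := {f | AnalyticOnNhd ℂ (ext0 f) U}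
  mul_mem' {f g} hf hg := analyticOnNhd_ext0 (hf.mul hg) fun z => by simp [ext0_apply]
  add_mem' {f g} hf hg := analyticOnNhd_ext0 (hf.add hg) fun z => by simp [ext0_apply]
  algebraMap_mem' c := analyticOnNhd_ext0 (F := fun _ => c) analyticOnNhd_const fun _ => rfl

/-- Restriction to `U` of a function analytic at each point of `U`. -/
def Hol.mk {U : Opens ℂ} (F : ℂ → ℂ) (hF : AnalyticOnNhd ℂ F U) : Hol U :=
  ⟨fun z => F z, analyticOnNhd_ext0 hF fun _ => rfl⟩

/-- The derivation `d/dz` of the algebra of analytic functions on `U`. -/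
def ddz (U : Opens ℂ) : Derivation ℂ (Hol U) (Hol U) :=
  Derivation.mk'
    { toFun := fun f => Hol.mk (deriv (ext0 f.1)) (AnalyticOnNhd.deriv f.2)
      map_add' := fun f g => by
        ext z
        have h := ext0_eventuallyEq (f.1 + g.1) (ext0 f.1 + ext0 g.1)
          (fun w => by simp [ext0_apply]) z
        change deriv (ext0 (f.1 + g.1)) z = deriv (ext0 f.1) z + deriv (ext0 g.1) z
        rw [← h.deriv_eq, deriv_add (f.2 z z.2).differentiableAt (g.2 z z.2).differentiableAt]
      map_smul' := fun c f => by
        ext z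
        have h := ext0_eventuallyEq (c • f.1) (c • ext0 f.1)
          (fun w => by simp [ext0_apply]) z
        change deriv (ext0 (c • f.1)) z = c • deriv (ext0 f.1) z
        rw [← h.deriv_eq, deriv_const_smul _ (f.2 z z.2).differentiableAt] }
    (fun f g => by
      ext z
      have h := ext0_eventuallyEq (f.1 * g.1) (ext0 f.1 * ext0 g.1)
        (fun w => by simp [ext0_apply]) z
      change deriv (ext0 (f.1 * g.1)) z
        = f.1 z * deriv (ext0 g.1) z + g.1 z * deriv (ext0 f.1) z
      rw [← h.deriv_eq, deriv_mul (f.2 z z.2).differentiableAt (g.2 z z.2).differentiableAt,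
        ext0_apply, ext0_apply]
      ring)

/-- Restriction of analytic functions to a smaller open set. -/
def res {U V : Opens ℂ} (hVU : V ≤ U) (f : Hol U) : Hol V :=
  Hol.mk (ext0 f.1) fun z hz => f.2 z (hVU hz)

/-- Analytic functions of `z ∈ U` and one Grassmann variable `θ`:
the pair `(u, v)` stands for `u(z) + v(z) θ`. -/
abbrev SFun (U : Opens ℂ) : Type := Hol U × Hol U

/-- Multiplication by the function `f(z)`. -/
def mulBy {U : Opens ℂ} (f : Hol U) : Module.End ℂ (SFun U) :=
  (LinearMap.mulLeft ℂ f).prodMap (LinearMap.mulLeft ℂ f)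

/-- The operator `∂_z`. -/
def dz (U : Opens ℂ) : Module.End ℂ (SFun U) :=
  (ddz U : Hol U →ₗ[ℂ] Hol U).prodMap (ddz U : Hol U →ₗ[ℂ] Hol U)

/-- Multiplication by `θ`: `u + v θ ↦ u θ`. -/
def mulTheta (U : Opens ℂ) : Module.End ℂ (SFun U) :=
  (0 : SFun U →ₗ[ℂ] Hol U).prod (LinearMap.fst ℂ (Hol U) (Hol U))

/-- The operator `∂_θ`: `u + v θ ↦ v`. -/
def dTheta (U : Opens ℂ) : Module.End ℂ (SFun U) :=
  (LinearMap.snd ℂ (Hol U) (Hol U)).prod 0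

/-- The even first-order operator `f(z) ∂_z + g(z) θ ∂_θ + h(z)`; products of operators are
compositions. -/
def evenOp {U : Opens ℂ} (f g h : Hol U) : Module.End ℂ (SFun U) :=
  mulBy f * dz U + mulBy g * (mulTheta U * dTheta U) + mulBy h

theorem evenOp_apply {U : Opens ℂ} (f g h : Hol U) (F : SFun U) :
    evenOp f g h F = (f * ddz U F.1 + h * F.1, f * ddz U F.2 + g * F.2 + h * F.2) := by
  simp [evenOp, mulBy, dz, mulTheta, dTheta]

theorem evenOp_lie {U : Opens ℂ} (f g h f' g' h' : Hol U) :
    ⁅evenOp f g h, evenOp f' g' h'⁆ =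
      evenOp (f * ddz U f' - f' * ddz U f) (f * ddz U g' - f' * ddz U g)
        (f * ddz U h' - f' * ddz U h) := by
  refine LinearMap.ext fun F => ?_
  rw [Ring.lie_def, LinearMap.sub_apply, Module.End.mul_apply, Module.End.mul_apply]
  simp only [evenOp_apply, map_add, Derivation.leibniz, smul_eq_mul]
  refine Prod.ext ?_ ?_
  · simp only [Prod.fst_sub]; ring
  · simp only [Prod.snd_sub]; ring

/-- The commutator of operators. -/
instance instLieRingEnd (U : Opens ℂ) : LieRing (Module.End ℂ (SFun U)) :=
  LieRing.ofAssociativeRing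

instance instLieAlgebraEnd (U : Opens ℂ) : LieAlgebra ℂ (Module.End ℂ (SFun U)) :=
  LieAlgebra.ofAssociativeAlgebra

/-- The Lie algebra (under the commutator) of all even first-order operators
`f(z) ∂_z + g(z) θ ∂_θ + h(z)` with coefficients analytic on `U`. -/
def d10 (U : Opens ℂ) : LieSubalgebra ℂ (Module.End ℂ (SFun U)) where
  carrier := {T | ∃ f g h : Hol U, T = evenOp f g h}
  zero_mem' := ⟨0, 0, 0, LinearMap.ext fun F => by simp [evenOp_apply]; rfl⟩
  add_mem' := by
    rintro _ _ ⟨f, g, h, rfl⟩ ⟨f', g', h', rfl⟩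
    refine ⟨f + f', g + g', h + h', LinearMap.ext fun F => ?_⟩
    simp only [LinearMap.add_apply, evenOp_apply, Prod.mk_add_mk]
    refine Prod.ext ?_ ?_ <;> dsimp only <;> ring
  smul_mem' := by
    rintro c _ ⟨f, g, h, rfl⟩
    refine ⟨c • f, c • g, c • h, LinearMap.ext fun F => ?_⟩
    simp only [LinearMap.smul_apply, evenOp_apply, Prod.smul_mk, smul_add, smul_mul_assoc]
  lie_mem' := by
    rintro _ _ ⟨f, g, h, rfl⟩ ⟨f', g', h', rfl⟩
    exact ⟨_, _, _, evenOp_lie f g h f' g' h'⟩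

/-! ### Equivalence transformations -/

/-- A biholomorphic change of variable `z̄ = φ(z)` from `V` onto `W`, a change of the odd variable
`θ̄ = β(z) θ`, and a gauge factor `α(z)`. A unit of the algebra of analytic functions is the same
as a non-vanishing analytic function. -/
structure Transf (V W : Opens ℂ) where
  φ : Hol V
  mapsTo : ∀ z : V, φ.1 z ∈ W
  bijective : Function.Bijective fun z : V => (⟨φ.1 z, mapsTo z⟩ : W)
  deriv_ne : ∀ z : V, (ddz V φ).1 z ≠ 0
  β : (Hol V)ˣ
  α : (Hol V)ˣ

/-- The function `u(φ(z))`. -/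
def Transf.comp {V W : Opens ℂ} (Φ : Transf V W) (u : Hol W) : Hol V :=
  ⟨fun z => u.1 ⟨Φ.φ.1 z, Φ.mapsTo z⟩,
    analyticOnNhd_ext0 (F := ext0 u.1 ∘ ext0 Φ.φ.1)
      (fun z hz => by
        have hz' : ext0 Φ.φ.1 z = Φ.φ.1 ⟨z, hz⟩ := ext0_apply Φ.φ.1 ⟨z, hz⟩
        refine AnalyticAt.comp ?_ (Φ.φ.2 z hz)
        rw [hz']
        exact u.2 _ (Φ.mapsTo ⟨z, hz⟩))
      (fun z => by
        simp only [Function.comp_apply, ext0_apply]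
        exact (ext0_apply u.1 ⟨Φ.φ.1 z, Φ.mapsTo z⟩).symm)⟩

/-- A function `F̄(z̄, θ̄)` in the new variables comes from the function
`F(z, θ) = α(z)⁻¹ F̄(φ(z), β(z) θ)` in the old ones, that is `F̄ = α F`. -/
def Transf.pull {V W : Opens ℂ} (Φ : Transf V W) (F : SFun W) : SFun V :=
  (((Φ.α⁻¹ : (Hol V)ˣ) : Hol V) * Φ.comp F.1,
    ((Φ.α⁻¹ : (Hol V)ˣ) : Hol V) * (Φ.β : Hol V) * Φ.comp F.2)

/-- `T'` is the operator `T` written in the new variables and gauge: `T' = α T α⁻¹`, that is,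
`T' F̄` corresponds to `T F` whenever `F̄` corresponds to `F`. -/
def Transf.Carries {V W : Opens ℂ} (Φ : Transf V W) (T : Module.End ℂ (SFun V))
    (T' : Module.End ℂ (SFun W)) : Prop :=
  ∀ F : SFun W, Φ.pull (T' F) = T (Φ.pull F)

/-- The space `N` of operators on `W` consists exactly of the transforms under `Φ` of the
restrictions to `V` of the elements of the algebra `l` of even operators on `U`. -/
def Transf.CarriesAlgebra {U V W : Opens ℂ} (Φ : Transf V W) (hVU : V ≤ U)
    (l : LieSubalgebra ℂ (Module.End ℂ (SFun U)))
    (N : Submodule ℂ (Module.End ℂ (SFun W))) : Prop :=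
  ∀ T' : Module.End ℂ (SFun W), T' ∈ N ↔
    ∃ f g h : Hol U, evenOp f g h ∈ l ∧
      Φ.Carries (evenOp (res hVU f) (res hVU g) (res hVU h)) T'

/-- The point `p` is regular if it is not a common zero of the vector field parts `f ∂_z` of the
elements of `l`, or if all these vector field parts are identically zero. -/
def IsRegularPoint {U : Opens ℂ} (l : LieSubalgebra ℂ (Module.End ℂ (SFun U))) (p : U) : Prop :=
  (∀ f g h : Hol U, evenOp f g h ∈ l → f = 0) ∨
    ∃ f g h : Hol U, evenOp f g h ∈ l ∧ f.1 p ≠ 0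

/-! ### The canonical forms -/

/-- The function `z ^ k * exp (μ z)`. -/
def expMon (W : Opens ℂ) (μ : ℂ) (k : ℕ) : Hol W :=
  Hol.mk (fun z => z ^ k * Complex.exp (μ * z)) fun z _ => by fun_prop

/-- The function `z ^ k`. -/
def mon (W : Opens ℂ) (k : ℕ) : Hol W := Hol.mk (fun z => z ^ k) fun z _ => by fun_prop

/-- The multiplicative operator `g(z) θ ∂_θ + h(z)`. These operators form the space
`𝓜 ⊗ 𝔞₀`, where `𝓜` is the space of analytic functions and `𝔞₀ = ⟨θ ∂_θ, 1⟩`. -/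
def aOp {W : Opens ℂ} (g h : Hol W) : Module.End ℂ (SFun W) := evenOp 0 g h

/-- An `𝔞₀`-translation bimodule: a finite-dimensional space of operators `g θ ∂_θ + h`
which is invariant under (the adjoint action of) `∂_z`. -/
def IsTranslationBimodule {W : Opens ℂ} (N : Submodule ℂ (Module.End ℂ (SFun W))) : Prop :=
  FiniteDimensional ℂ N ∧ (∀ T ∈ N, ∃ g h : Hol W, T = aOp g h) ∧ ∀ T ∈ N, ⁅dz W, T⁆ ∈ N

/-- The coefficient `c^{μ,k}_j` in terms of the free constants `c^{μ,1}, c^{μ,2}, …`. Everything is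
counted from zero: `a = m_μ + 1`, `b = n_μ + 1`, `k` and `j` stand for `k - 1` and `j - 1`, and
`c l` is `c^{μ,l+1}`. -/
def mixedCoeff (a b : ℕ) (c : ℕ → ℂ) (k j : ℕ) : ℂ :=
  ((a + k).factorial * b.factorial : ℂ) / ((b + j).factorial * (a + k - j).factorial) * c (k - j)

/-- The space `𝔪(𝔞₀, M)` with `v₁ = θ ∂_θ`, `v₂ = 1`, where `a μ = m_μ + 1`, `b μ = n_μ + 1`. It is
spanned, for `μ ∈ M`, by `z^k e^{μz} v₁` (`0 ≤ k ≤ m_μ`), by `z^k e^{μz} v₂` (`0 ≤ k ≤ n_μ`), and by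
`e^{μz} (z^{m_μ+k} v₁ + z^{n_μ} ∑_{j=1}^k c^{μ,k}_j z^j v₂)` (`1 ≤ k ≤ r_μ`). -/
def bimodule (W : Opens ℂ) (M : Finset ℂ) (a b r : ℂ → ℕ) (c : ℂ → ℕ → ℂ) :
    Submodule ℂ (Module.End ℂ (SFun W)) :=
  Submodule.span ℂ
    ({T | ∃ μ ∈ M, ∃ k < a μ, T = aOp (expMon W μ k) 0} ∪
     {T | ∃ μ ∈ M, ∃ k < b μ, T = aOp 0 (expMon W μ k)} ∪
     {T | ∃ μ ∈ M, ∃ k < r μ, T = aOp (expMon W μ (a μ + k))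
        (∑ j ∈ Finset.range (k + 1),
          mixedCoeff (a μ) (b μ) (c μ) k j • expMon W μ (b μ + j))})

/-- The space `𝔪₀(𝔞₀)`, where `a = m + 1`, `b = n + 1`: the span of `z^i θ∂_θ` (`0 ≤ i ≤ m`),
`z^j` (`0 ≤ j ≤ n`) and `z^k (z^m θ∂_θ + c_k z^n)` (`1 ≤ k ≤ r`), with
`c_k = (m+k)! (n+1)! / ((n+k)! (m+1)!) c`. -/
def bimodule₀ (W : Opens ℂ) (a b r : ℕ) (c : ℂ) : Submodule ℂ (Module.End ℂ (SFun W)) :=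
  Submodule.span ℂ
    ({T | ∃ i < a, T = aOp (mon W i) 0} ∪
     {T | ∃ j < b, T = aOp 0 (mon W j)} ∪
     {T | ∃ k < r, T = aOp (mon W (a + k))
        ((((a + k).factorial * b.factorial : ℂ) / ((b + k).factorial * a.factorial) * c) •
          mon W (b + k))})

/-- The family `𝔩⁰`. -/
def IsForm0 {W : Opens ℂ} (N : Submodule ℂ (Module.End ℂ (SFun W))) : Prop :=
  ∃ (m : ℕ) (g h : Fin m → Hol W), LinearIndependent ℂ (fun i => aOp (g i) (h i)) ∧
    N = Submodule.span ℂ (Set.range fun i => aOp (g i) (h i))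

/-- The family `𝔩¹ = ⟨∂_z ; 𝔪(𝔞₀, M)⟩`. -/
def IsForm1 {W : Opens ℂ} (N : Submodule ℂ (Module.End ℂ (SFun W))) : Prop :=
  ∃ (M : Finset ℂ) (a b r : ℂ → ℕ) (c : ℂ → ℕ → ℂ),
    (∀ μ ∈ M, 0 < r μ → c μ 0 ≠ 0) ∧
    IsTranslationBimodule (bimodule W M a b r c) ∧
    N = Submodule.span ℂ {dz W} ⊔ bimodule W M a b r c

/-- The family `𝔩² = ⟨∂_z, z∂_z + αθ∂_θ + β ; 𝔪₀(𝔞₀)⟩`, with `m = n` if mixed generators occur. -/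
def IsForm2 {W : Opens ℂ} (N : Submodule ℂ (Module.End ℂ (SFun W))) : Prop :=
  ∃ (α β c : ℂ) (a b r : ℕ), c ≠ 0 ∧ (1 ≤ r → a = b) ∧
    N = Submodule.span ℂ {dz W, evenOp (mon W 1) (α • 1) (β • 1)} ⊔ bimodule₀ W a b r c

/-- The family `𝔩³ = ⟨∂_z, z∂_z + αθ∂_θ + β, z²∂_z + 2αzθ∂_θ + 2βz ; θ∂_θ + γ, 1⟩`; each of the last
two generators may be present or absent. -/
def IsForm3 {W : Opens ℂ} (N : Submodule ℂ (Module.End ℂ (SFun W))) : Prop :=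
  ∃ (α β γ : ℂ) (S : Set (Module.End ℂ (SFun W))), S ⊆ {aOp 1 (γ • 1), aOp 0 1} ∧
    N = Submodule.span ℂ
      ({dz W, evenOp (mon W 1) (α • 1) (β • 1),
        evenOp (mon W 2) ((2 * α) • mon W 1) ((2 * β) • mon W 1)} ∪ S)

end EvenOps

end

/-!
Regularity is a matter of the coefficient `f`: if some `f` is not identically zero, its zeros are
isolated, which gives density.

Near a point where some vector field part does not vanish, these parts form a finite-dimensional Lie
algebra of vector fields on the line. An eigenvector of the adjoint action of a nonvanishing element
provides a coordinate in which this algebra is `⟨∂_z⟩`, `⟨∂_z, z∂_z⟩` or `⟨∂_z, z∂_z, z²∂_z⟩`.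
Rescaling `θ` and gauging change the multiplicative coefficients `(g, h)` of `f∂_z + gθ∂_θ + h` by
`f • ξ` with `ξ` arbitrary, so those of the lift of `∂_z` can be made to vanish.

The operators with `f = 0` then form a finite-dimensional space of pairs `(g, h)` invariant under
`d/dz`. It is the sum of its generalized eigenspaces, each of which is `e^{μz}` times a
translation-invariant space of pairs of polynomials. Such a space is determined by the pairs with
one vanishing component and by one chain of mixed pairs, whose lower members are recovered from the
last one by differentiating. If `z∂_z` is present then `μ = 0` and the mixed pairs are
homogeneous; if `z²∂_z` is present as well then all pairs are constant.
-/

noncomputable section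

namespace EvenOps

open Polynomial

variable {U V W : Opens ℂ}

/-! ### Linear algebra -/

section LinearAlgebra

variable {R M N : Type*} [CommRing R] [AddCommGroup M] [Module R M] [AddCommGroup N] [Module R N]

theorem eq_of_map_fst_le_of_comap_inr_le {P Q : Submodule R (M × N)} (hQP : Q ≤ P)
    (hfst : P.map (LinearMap.fst R M N) ≤ Q.map (LinearMap.fst R M N))
    (hinr : P.comap (LinearMap.inr R M N) ≤ Q.comap (LinearMap.inr R M N)) : P = Q := by
  refine le_antisymm (fun x hx => ?_) hQP
  obtain ⟨y, hy, hyx⟩ := hfst (Submodule.mem_map_of_mem hx)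
  have hxy : x - y = LinearMap.inr R M N (x.2 - y.2) :=
    Prod.ext (sub_eq_zero.2 hyx.symm) rfl
  have hmem : x - y ∈ Q := by
    rw [hxy]
    exact hinr (show LinearMap.inr R M N (x.2 - y.2) ∈ P from hxy ▸ P.sub_mem hx (hQP hy))
  simpa using Q.add_mem hmem hy

theorem forall_apply_mem_map {f : Module.End R M} {g : Module.End R N} {h : M →ₗ[R] N}
    (hfg : ∀ x, h (f x) = g (h x)) {A : Submodule R M} (hA : ∀ x ∈ A, f x ∈ A) :
    ∀ y ∈ A.map h, g y ∈ A.map h := by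
  rintro _ ⟨x, hx, rfl⟩
  exact ⟨f x, hA x hx, hfg x⟩

theorem apply_mem_maxGenEigenspace {f : Module.End R M} {g : Module.End R N} {h : M →ₗ[R] N}
    (hfg : ∀ x, h (f x) = g (h x)) {μ : R} {x : M} (hx : x ∈ f.maxGenEigenspace μ) :
    h x ∈ g.maxGenEigenspace μ := by
  rw [Module.End.mem_maxGenEigenspace] at hx ⊢
  obtain ⟨n, hn⟩ := hx
  have hcomm : (g - μ • 1) ∘ₗ h = h ∘ₗ (f - μ • 1) := LinearMap.ext fun y => by simp [hfg]
  refine ⟨n, ?_⟩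
  rw [← LinearMap.comp_apply, Module.End.commute_pow_left_of_commute hcomm, LinearMap.comp_apply,
    hn, map_zero]

end LinearAlgebra

section VectorSpaces

variable {K E F : Type*} [Field K] [AddCommGroup E] [Module K E] [AddCommGroup F] [Module K F]

theorem finiteDimensional_comap {f : E →ₗ[K] F} (hf : Function.Injective f) (A : Submodule K F)
    [FiniteDimensional K A] : FiniteDimensional K (A.comap f) := by
  have : FiniteDimensional K f.ker := by rw [LinearMap.ker_eq_bot.2 hf]; infer_instance
  infer_instance

theorem le_iSup_inf_maxGenEigenspace [IsAlgClosed K] {f : Module.End K E} {A : Submodule K E}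
    [FiniteDimensional K A] (hA : ∀ x ∈ A, f x ∈ A) : A ≤ ⨆ μ, A ⊓ f.maxGenEigenspace μ := by
  have htop := congrArg (Submodule.map A.subtype)
    (Module.End.iSup_maxGenEigenspace_eq_top (f.restrict hA))
  rw [Submodule.map_iSup, Submodule.map_top, Submodule.range_subtype] at htop
  exact htop.ge.trans (iSup_mono fun μ => (Submodule.inf_genEigenspace f A hA).ge)

theorem exists_mem_apply_eq {f : Module.End K E} {A : Submodule K E} [FiniteDimensional K A]
    (hA : ∀ x ∈ A, f x ∈ A) (hf : ∀ x ∈ A, f x = 0 → x = 0) : ∀ y ∈ A, ∃ x ∈ A, f x = y := by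
  intro y hy
  have hinj : Function.Injective (f.restrict hA) :=
    (injective_iff_map_eq_zero _).2 fun x hx => Subtype.ext (hf x x.2 (congrArg Subtype.val hx))
  obtain ⟨x, hx⟩ := LinearMap.surjective_of_injective hinj ⟨y, hy⟩
  exact ⟨x, x.2, congrArg Subtype.val hx⟩

theorem exists_mem_apply_eq_smul [IsAlgClosed K] {f : Module.End K E} {A : Submodule K E}
    [FiniteDimensional K A] (hA : ∀ x ∈ A, f x ∈ A) (hbot : A ≠ ⊥) :
    ∃ x ∈ A, x ≠ 0 ∧ ∃ c : K, f x = c • x := by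
  have : Nontrivial A := Submodule.nontrivial_iff_ne_bot.2 hbot
  obtain ⟨c, hc⟩ := Module.End.exists_eigenvalue (f.restrict hA)
  obtain ⟨x, hx⟩ := hc.exists_hasEigenvector
  exact ⟨x, x.2, fun h => hx.2 (Subtype.ext h), c, congrArg Subtype.val hx.apply_eq_smul⟩

theorem exists_apply_eq_smul_or_apply_eq_smul [IsAlgClosed K] {f : Module.End K E}
    {A : Submodule K E} [FiniteDimensional K A] (hA : ∀ x ∈ A, f x ∈ A) {v : E} (hv : v ∈ A)
    (hfv : f v = 0) (hle : ¬A ≤ Submodule.span K {v}) :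
    ∃ w ∈ A, w ∉ Submodule.span K {v} ∧ ((∃ c ≠ (0 : K), f w = c • w) ∨ ∃ c : K, f w = c • v) := by
  set L := Submodule.span K {v}
  have hL : L ≤ L.comap f := by simp [L, Submodule.span_le, hfv]
  obtain ⟨_, ⟨w, hw, rfl⟩, hw0, c, hc⟩ := exists_mem_apply_eq_smul (f := L.mapQ L f hL)
    (forall_apply_mem_map (h := L.mkQ) (fun _ => rfl) hA)
    (by rwa [Ne, ← LinearMap.le_ker_iff_map, Submodule.ker_mkQ])
  rw [Submodule.mkQ_apply, Ne, Submodule.Quotient.mk_eq_zero] at hw0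
  rw [Submodule.mkQ_apply, Submodule.mapQ_apply, ← Submodule.Quotient.mk_smul,
    Submodule.Quotient.eq] at hc
  obtain ⟨d, hd⟩ := Submodule.mem_span_singleton.1 hc
  have hfw : f w = c • w + d • v := by rw [hd]; abel
  rcases eq_or_ne c 0 with rfl | hc0
  · exact ⟨w, hw, hw0, Or.inr ⟨d, by rw [hfw, zero_smul, zero_add]⟩⟩
  · have hdv : (c⁻¹ * d) • v ∈ L := L.smul_mem _ (Submodule.mem_span_singleton_self v)
    refine ⟨w + (c⁻¹ * d) • v, A.add_mem hw (A.smul_mem _ hv),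
      fun h => hw0 ((L.add_mem_iff_left hdv).1 h), Or.inl ⟨c, hc0, ?_⟩⟩
    rw [map_add, map_smul, hfv, smul_zero, add_zero, hfw, smul_add, smul_smul,
      mul_inv_cancel_left₀ hc0]

theorem exists_subset_pair_span_eq (Q : Submodule K (K × K)) :
    ∃ (γ : K) (S : Set (K × K)), S ⊆ {(1, γ), (0, 1)} ∧ Submodule.span K S = Q := by
  obtain ⟨γ, hγ⟩ : ∃ γ : K, ∀ x ∈ Q, x.1 ≠ 0 → (1, γ) ∈ Q := by
    by_cases h : ∃ x ∈ Q, x.1 ≠ 0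
    · obtain ⟨x, hx, hx1⟩ := h
      refine ⟨x.1⁻¹ * x.2, fun _ _ _ => ?_⟩
      have hmem := Q.smul_mem x.1⁻¹ hx
      rwa [Prod.smul_def, smul_eq_mul, smul_eq_mul, inv_mul_cancel₀ hx1] at hmem
    · exact ⟨0, fun x hx hx1 => absurd ⟨x, hx, hx1⟩ h⟩
  set S : Set (K × K) := {(1, γ), (0, 1)} ∩ Q
  refine ⟨γ, S, Set.inter_subset_left, Eq.symm ?_⟩
  refine eq_of_map_fst_le_of_comap_inr_le (Submodule.span_le.2 Set.inter_subset_right) ?_ ?_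
  · rintro _ ⟨x, hx, rfl⟩
    by_cases hx1 : x.1 = 0
    · simp [hx1]
    · have hS : (1, γ) ∈ S := ⟨Or.inl rfl, hγ x hx hx1⟩
      exact ⟨x.1 • (1, γ), Submodule.smul_mem _ _ (Submodule.subset_span hS), by simp⟩
  · intro y hy
    by_cases hy0 : y = 0
    · simp [hy0]
    · have hS : (0, 1) ∈ S :=
        ⟨Or.inr rfl, by simpa [inv_mul_cancel₀ hy0] using Q.smul_mem y⁻¹ hy⟩
      simpa using Submodule.smul_mem _ y (Submodule.subset_span hS)

end VectorSpaces

/-! ### Spaces of polynomials invariant under derivations -/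

section Polynomials

theorem mem_degreeLT_iff_coeff {R : Type*} [Semiring R] {n : ℕ} {p : R[X]} :
    p ∈ degreeLT R n ↔ ∀ m, n ≤ m → p.coeff m = 0 := by
  rw [mem_degreeLT, degree_lt_iff_coeff_zero]

theorem X_pow_mem_degreeLT {R : Type*} [Semiring R] [Nontrivial R] {k n : ℕ} :
    (X ^ k : R[X]) ∈ degreeLT R n ↔ k < n := by
  rw [mem_degreeLT, degree_X_pow, Nat.cast_lt]

theorem degreeLT_zero_eq_bot (R : Type*) [Semiring R] : degreeLT R 0 = ⊥ :=
  (Submodule.eq_bot_iff _).2 fun p hp => by simpa [mem_degreeLT] using hp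

variable {K : Type*} [Field K]

theorem degreeLT_succ_le {Q : Submodule K K[X]} {d : ℕ} (hQ : degreeLT K d ≤ Q) {p : K[X]}
    (hpQ : p ∈ Q) (hp : p ∈ degreeLT K (d + 1)) (hpd : p.coeff d ≠ 0) :
    degreeLT K (d + 1) ≤ Q := by
  intro q hq
  have hsub : q - (q.coeff d / p.coeff d) • p ∈ degreeLT K d := by
    rw [mem_degreeLT_iff_coeff] at hp hq ⊢
    intro m hm
    rcases hm.eq_or_lt with rfl | hm
    · rw [coeff_sub, coeff_smul, smul_eq_mul, div_mul_cancel₀ _ hpd, sub_self]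
    · rw [coeff_sub, coeff_smul, hp m hm, hq m hm, smul_zero, sub_zero]
  simpa using Q.add_mem (hQ hsub) (Q.smul_mem (q.coeff d / p.coeff d) hpQ)

variable [CharZero K]

theorem derivative_mem_degreeLT {n : ℕ} {p : K[X]} :
    derivative p ∈ degreeLT K n ↔ p ∈ degreeLT K (n + 1) := by
  simp only [mem_degreeLT_iff_coeff, coeff_derivative]
  constructor
  · rintro h (_ | m) hm
    · omega
    · exact (mul_eq_zero.1 (h m (by omega))).resolve_right (Nat.cast_add_one_ne_zero m)
  · intro h m hm
    rw [h (m + 1) (by omega), zero_mul]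

theorem degreeLT_succ_le_of_derivative_mem {Q : Submodule K K[X]}
    (hQ : ∀ p ∈ Q, derivative p ∈ Q) {d : ℕ} {p : K[X]} (hpQ : p ∈ Q)
    (hp : p ∈ degreeLT K (d + 1)) (hpd : p.coeff d ≠ 0) : degreeLT K (d + 1) ≤ Q := by
  induction d generalizing p with
  | zero => exact degreeLT_succ_le ((degreeLT_zero_eq_bot K).trans_le bot_le) hpQ hp hpd
  | succ d ih =>
    refine degreeLT_succ_le (ih (hQ p hpQ) (derivative_mem_degreeLT.2 hp) ?_) hpQ hp hpd
    rw [coeff_derivative]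
    exact mul_ne_zero hpd (Nat.cast_add_one_ne_zero d)

theorem exists_eq_degreeLT (Q : Submodule K K[X]) [FiniteDimensional K Q]
    (hQ : ∀ p ∈ Q, derivative p ∈ Q) : ∃ n, Q = degreeLT K n := by
  obtain ⟨s, hs⟩ := (Submodule.fg_iff_finiteDimensional Q).2 inferInstance
  obtain ⟨n, hn⟩ := span_of_finite_le_degreeLT (R := K) s.finite_toSet
  rw [hs] at hn
  induction n with
  | zero => exact ⟨0, le_antisymm hn ((degreeLT_zero_eq_bot K).trans_le bot_le)⟩
  | succ n ih =>
    by_cases h : ∃ p ∈ Q, p.coeff n ≠ 0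
    · obtain ⟨p, hpQ, hpn⟩ := h
      exact ⟨n + 1, le_antisymm hn (degreeLT_succ_le_of_derivative_mem hQ hpQ (hn hpQ) hpn)⟩
    · push Not at h
      refine ih fun p hp => mem_degreeLT_iff_coeff.2 fun m hm => ?_
      rcases hm.eq_or_lt with rfl | hm
      · exact h p hp
      · exact mem_degreeLT_iff_coeff.1 (hn hp) m hm

theorem exists_derivative_eq (p : K[X]) : ∃ q : K[X], derivative q = p := by
  induction p using Polynomial.induction_on' with
  | add p q hp hq =>
    obtain ⟨p, rfl⟩ := hp
    obtain ⟨q, rfl⟩ := hq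
    exact ⟨p + q, map_add _ _ _⟩
  | monomial n a =>
    refine ⟨monomial (n + 1) (a / (n + 1 : ℕ)), ?_⟩
    rw [derivative_monomial, Nat.add_sub_cancel,
      div_mul_cancel₀ _ (Nat.cast_ne_zero.2 n.succ_ne_zero)]

theorem X_pow_mul_derivative_X_pow {R : Type*} [CommSemiring R] (m k : ℕ) :
    (X ^ (m + 1) * derivative (X ^ k) : R[X]) = (k : R) • X ^ (k + m) := by
  rcases k with _ | k
  · simp
  · rw [derivative_X_pow, Nat.add_sub_cancel, ← smul_eq_C_mul, mul_smul_comm, ← pow_add,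
      show m + 1 + k = k + 1 + m by omega]

theorem X_mul_derivative_X_pow {R : Type*} [CommSemiring R] (k : ℕ) :
    (X * derivative (X ^ k) : R[X]) = (k : R) • X ^ k := by
  simpa using X_pow_mul_derivative_X_pow (R := R) 0 k

theorem le_degreeLT_one_of_X_sq_mul_derivative_mem (Q : Submodule K K[X]) [FiniteDimensional K Q]
    (hQ : ∀ p ∈ Q, derivative p ∈ Q) (hsq : ∀ p ∈ Q, X ^ 2 * derivative p ∈ Q) :
    Q ≤ degreeLT K 1 := by
  obtain ⟨n, rfl⟩ := exists_eq_degreeLT Q hQ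
  refine degreeLT_mono ?_
  by_contra! hn
  have hmem := hsq (X ^ (n - 1)) (X_pow_mem_degreeLT.2 (by omega))
  rw [X_pow_mul_derivative_X_pow, Submodule.smul_mem_iff _ (Nat.cast_ne_zero.2 (by omega)),
    X_pow_mem_degreeLT] at hmem
  omega

theorem eq_bot_of_X_mul_derivative_add_mem (Q : Submodule K K[X]) [FiniteDimensional K Q]
    (hQ : ∀ p ∈ Q, derivative p ∈ Q) {μ : K} (hμ : μ ≠ 0)
    (hE : ∀ p ∈ Q, X * (derivative p + μ • p) ∈ Q) : Q = ⊥ := by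
  obtain ⟨n, rfl⟩ := exists_eq_degreeLT Q hQ
  rcases n with _ | n
  · exact degreeLT_zero_eq_bot K
  · have hX : (X ^ n : K[X]) ∈ degreeLT K (n + 1) := X_pow_mem_degreeLT.2 n.lt_succ_self
    have hmem := hE _ hX
    rw [mul_add, X_mul_derivative_X_pow, mul_smul_comm, ← pow_succ',
      Submodule.add_mem_iff_right _ (Submodule.smul_mem _ _ hX), Submodule.smul_mem_iff _ hμ,
      X_pow_mem_degreeLT] at hmem
    exact absurd hmem (lt_irrefl _)

theorem eq_degreeLT_two_or_three_of_wronskian_mem (Q : Submodule K K[X]) [FiniteDimensional K Q]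
    (hone : 1 ∈ Q) (hX : X ∈ Q) (hQ : ∀ p ∈ Q, ∀ q ∈ Q, wronskian p q ∈ Q) :
    Q = degreeLT K 2 ∨ Q = degreeLT K 3 := by
  obtain ⟨n, rfl⟩ := exists_eq_degreeLT Q fun p hp => by simpa [wronskian] using hQ 1 hone p hp
  have hn : 1 < n := by rwa [← pow_one X, X_pow_mem_degreeLT] at hX
  suffices n ≤ 3 by
    obtain rfl | rfl : n = 2 ∨ n = 3 := by omega
    exacts [Or.inl rfl, Or.inr rfl]
  by_contra! hn3
  obtain ⟨m, rfl⟩ := Nat.exists_eq_add_of_le' (show 4 ≤ n from hn3)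
  have hmem := hQ (X ^ (m + 2)) (X_pow_mem_degreeLT.2 (by omega)) (X ^ (m + 3))
    (X_pow_mem_degreeLT.2 (by omega))
  have hw : wronskian (X ^ (m + 2)) (X ^ (m + 3)) = (X ^ (2 * m + 4) : K[X]) := by
    simp only [wronskian, derivative_X_pow, Nat.cast_add, Nat.cast_ofNat,
      map_add, map_natCast, map_ofNat, show m + 3 - 1 = m + 2 by omega,
      show m + 2 - 1 = m + 1 by omega]
    ring
  rw [hw, X_pow_mem_degreeLT] at hmem
  omega

end Polynomials

/-! ### Translation-invariant spaces of pairs of polynomials -/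

section MixedPolynomials

theorem mixedCoeff_eq_mul (a b : ℕ) (c : ℕ → ℂ) (k j : ℕ) :
    mixedCoeff a b c k j = mixedCoeff a b 1 k j * c (k - j) := by
  simp [mixedCoeff]

theorem mixedCoeff_ne_zero (a b : ℕ) {c : ℕ → ℂ} {k j : ℕ} (hc : c (k - j) ≠ 0) :
    mixedCoeff a b c k j ≠ 0 :=
  mul_ne_zero (div_ne_zero (by exact_mod_cast by positivity) (by exact_mod_cast by positivity)) hc

theorem mixedCoeff_succ_succ (a b : ℕ) (c : ℕ → ℂ) {k j : ℕ} (hj : j ≤ k) :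
    mixedCoeff a b c (k + 1) (j + 1) * (b + j + 1 : ℂ) =
      (a + k + 1 : ℂ) * mixedCoeff a b c k j := by
  unfold mixedCoeff
  rw [show a + (k + 1) - (j + 1) = a + k - j by omega, show k + 1 - (j + 1) = k - j by omega,
    ← add_assoc, ← add_assoc, Nat.factorial_succ (a + k), Nat.factorial_succ (b + j)]
  have h1 : (b + j + 1 : ℂ) ≠ 0 := by exact_mod_cast Nat.succ_ne_zero (b + j)
  push_cast
  field_simp

/-- The polynomial `∑_{j ≤ k} c_j X ^ (b + j)`, with `c_j = mixedCoeff a b c k j`, which accompanies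
`X ^ (a + k)` in the mixed generators of a translation bimodule; `k` and `j` are counted from
zero, as in `mixedCoeff`. -/
def mixedPoly (a b : ℕ) (c : ℕ → ℂ) (k : ℕ) : ℂ[X] :=
  ∑ j ∈ Finset.range (k + 1), mixedCoeff a b c k j • X ^ (b + j)

theorem coeff_mixedPoly (a b : ℕ) (c : ℕ → ℂ) (k j : ℕ) :
    (mixedPoly a b c k).coeff (b + j) = if j ≤ k then mixedCoeff a b c k j else 0 := by
  simp [mixedPoly, finsetSum_coeff, coeff_X_pow]

theorem mixedPoly_zero (a b : ℕ) (c : ℕ → ℂ) :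
    mixedPoly a b c 0 = mixedCoeff a b c 0 0 • X ^ b := by
  simp [mixedPoly]

theorem derivative_mixedPoly_succ (a b : ℕ) (c : ℕ → ℂ) (k : ℕ) :
    derivative (mixedPoly a b c (k + 1)) = (a + k + 1 : ℂ) • mixedPoly a b c k +
      (mixedCoeff a b c (k + 1) 0 * b) • X ^ (b - 1) := by
  rw [mixedPoly, mixedPoly, Finset.sum_range_succ', map_add, map_sum, Finset.smul_sum]
  congr 1
  · refine Finset.sum_congr rfl fun j hj => ?_
    rw [derivative_smul, derivative_X_pow, ← smul_eq_C_mul, smul_smul, smul_smul,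
      ← mixedCoeff_succ_succ a b c (Nat.lt_succ_iff.1 (Finset.mem_range.1 hj))]
    simp [add_assoc]
  · rw [derivative_smul, derivative_X_pow, ← smul_eq_C_mul, smul_smul, add_zero]

theorem exists_sub_mixedPoly_mem_degreeLT (a b : ℕ) {r : ℕ} {h : ℂ[X]}
    (hh : h ∈ degreeLT ℂ (b + r + 1)) : ∃ c : ℕ → ℂ, h - mixedPoly a b c r ∈ degreeLT ℂ b := by
  refine ⟨fun i => h.coeff (b + (r - i)) / mixedCoeff a b 1 r (r - i), ?_⟩
  rw [mem_degreeLT_iff_coeff] at hh ⊢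
  intro m hm
  obtain ⟨j, rfl⟩ := Nat.exists_eq_add_of_le hm
  rw [coeff_sub, coeff_mixedPoly, sub_eq_zero]
  split_ifs with hj
  · rw [mixedCoeff_eq_mul, Nat.sub_sub_self hj,
      mul_div_cancel₀ _ (mixedCoeff_ne_zero a b one_ne_zero)]
  · exact hh _ (by omega)

end MixedPolynomials

section PolynomialPairs

variable {a b r : ℕ}

/-- The pairs `(X ^ k, 0)`, `k < a`, the pairs `(0, X ^ k)`, `k < b`, and the mixed pairs
`(X ^ (a + k), q k)`, `k < r`: the shape common to the generators of `bimodule` (for one exponent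
`μ`) and of `bimodule₀`, the pair `(g, h)` standing for `g θ ∂_θ + h`. -/
def pairGens {R : Type*} [Semiring R] (a b r : ℕ) (q : ℕ → R[X]) : Set (R[X] × R[X]) :=
  {x | ∃ k < a, x = (X ^ k, 0)} ∪ {x | ∃ k < b, x = (0, X ^ k)} ∪
    {x | ∃ k < r, x = (X ^ (a + k), q k)}

section
variable {R : Type*} [CommRing R] {q : ℕ → R[X]}

theorem span_pairGens_le {P : Submodule R (R[X] × R[X])} :
    Submodule.span R (pairGens a b r q) ≤ P ↔ (∀ k < a, (X ^ k, 0) ∈ P) ∧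
      (∀ k < b, (0, X ^ k) ∈ P) ∧ ∀ k < r, (X ^ (a + k), q k) ∈ P := by
  simp only [Submodule.span_le, pairGens, Set.union_subset_iff, Set.ofPred_subset, and_assoc,
    SetLike.mem_coe, forall_exists_index, and_imp]
  grind

theorem degreeLT_le_iff {n : ℕ} {Q : Submodule R R[X]} :
    degreeLT R n ≤ Q ↔ ∀ k < n, X ^ k ∈ Q := by
  classical
  simp [degreeLT_eq_span_X_pow, Submodule.span_le, Set.subset_def]

theorem eq_span_pairGens {P : Submodule R (R[X] × R[X])}
    (hinl : degreeLT R a ≤ P.comap (LinearMap.inl R R[X] R[X]))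
    (hinr : P.comap (LinearMap.inr R R[X] R[X]) = degreeLT R b)
    (hfst : P.map (LinearMap.fst R R[X] R[X]) ≤ degreeLT R (a + r))
    (hq : ∀ k < r, (X ^ (a + k), q k) ∈ P) : P = Submodule.span R (pairGens a b r q) := by
  obtain ⟨hinl', hinr', hq'⟩ := span_pairGens_le.1 (le_refl (Submodule.span R (pairGens a b r q)))
  refine eq_of_map_fst_le_of_comap_inr_le (span_pairGens_le.2
    ⟨degreeLT_le_iff.1 hinl, degreeLT_le_iff.1 hinr.ge, hq⟩) (hfst.trans ?_)
    (hinr.trans_le (degreeLT_le_iff.2 hinr'))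
  refine degreeLT_le_iff.2 fun k hk => ?_
  rcases lt_or_ge k a with hka | hka
  · exact ⟨_, hinl' k hka, rfl⟩
  · obtain ⟨j, rfl⟩ := Nat.exists_eq_add_of_le hka
    exact ⟨_, hq' j (by omega), rfl⟩

end

theorem snd_mem_degreeLT_add {K : Type*} [Field K] [CharZero K] {P : Submodule K (K[X] × K[X])}
    (hP : ∀ x ∈ P, (derivative x.1, derivative x.2) ∈ P)
    (hinl : degreeLT K a ≤ P.comap (LinearMap.inl K K[X] K[X]))
    (hinr : P.comap (LinearMap.inr K K[X] K[X]) ≤ degreeLT K b) {i : ℕ} {x : K[X] × K[X]}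
    (hx : x ∈ P) (hx1 : x.1 ∈ degreeLT K (a + i)) : x.2 ∈ degreeLT K (b + i) := by
  induction i generalizing x with
  | zero =>
    have hsub : x - (x.1, 0) = (0, x.2) := Prod.ext (sub_self _) (sub_zero _)
    exact hinr (show (0, x.2) ∈ P from hsub ▸ P.sub_mem hx (hinl hx1))
  | succ i ih => exact derivative_mem_degreeLT.1 (ih (hP x hx) (derivative_mem_degreeLT.2 hx1))

variable {P : Submodule ℂ (ℂ[X] × ℂ[X])} {c : ℕ → ℂ}

theorem X_pow_mixedPoly_mem_of_succ (hP : ∀ x ∈ P, (derivative x.1, derivative x.2) ∈ P)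
    (hinr : degreeLT ℂ b ≤ P.comap (LinearMap.inr ℂ ℂ[X] ℂ[X])) {k : ℕ}
    (hk : (X ^ (a + (k + 1)), mixedPoly a b c (k + 1)) ∈ P) :
    (X ^ (a + k), mixedPoly a b c k) ∈ P := by
  have hlow : (mixedCoeff a b c (k + 1) 0 * b) • X ^ (b - 1) ∈ degreeLT ℂ b := by
    rcases b with _ | b
    · simp
    · exact Submodule.smul_mem _ _ (X_pow_mem_degreeLT.2 (by omega))
  have hne : (a + k + 1 : ℂ) ≠ 0 := by exact_mod_cast Nat.succ_ne_zero (a + k)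
  rw [← Submodule.smul_mem_iff _ hne]
  convert P.sub_mem (hP _ hk) (hinr hlow) using 1
  refine Prod.ext ?_ ?_
  · simp [← add_assoc, smul_eq_C_mul]
  · simp [derivative_mixedPoly_succ]

theorem exists_X_pow_mixedPoly_mem (hP : ∀ x ∈ P, (derivative x.1, derivative x.2) ∈ P)
    (hinl : degreeLT ℂ a ≤ P.comap (LinearMap.inl ℂ ℂ[X] ℂ[X]))
    (hinr : P.comap (LinearMap.inr ℂ ℂ[X] ℂ[X]) = degreeLT ℂ b)
    (hfst : degreeLT ℂ (a + r) ≤ P.map (LinearMap.fst ℂ ℂ[X] ℂ[X])) :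
    ∃ c : ℕ → ℂ, ∀ k < r, (X ^ (a + k), mixedPoly a b c k) ∈ P := by
  rcases r with _ | r
  · exact ⟨0, by simp⟩
  obtain ⟨⟨_, h⟩, hx, rfl⟩ := hfst (X_pow_mem_degreeLT.2 (Nat.lt_succ_self (a + r)))
  obtain ⟨c, hc⟩ := exists_sub_mixedPoly_mem_degreeLT a b (snd_mem_degreeLT_add hP hinl hinr.le
    (i := r + 1) hx (X_pow_mem_degreeLT.2 (by omega)))
  refine ⟨c, fun k hk => Nat.decreasingInduction' (n := r)
    (P := fun k => (X ^ (a + k), mixedPoly a b c k) ∈ P)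
    (fun k _ _ ih => X_pow_mixedPoly_mem_of_succ hP hinr.ge ih) (by omega) ?_⟩
  simpa using P.sub_mem hx (hinr.ge hc)

theorem exists_eq_span_pairGens_mixedPoly (P : Submodule ℂ (ℂ[X] × ℂ[X])) [FiniteDimensional ℂ P]
    (hP : ∀ x ∈ P, (derivative x.1, derivative x.2) ∈ P) :
    ∃ (a b r : ℕ) (c : ℕ → ℂ), (0 < r → c 0 ≠ 0) ∧
      P.comap (LinearMap.inr ℂ ℂ[X] ℂ[X]) = degreeLT ℂ b ∧
      P = Submodule.span ℂ (pairGens a b r (mixedPoly a b c)) := by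
  have := finiteDimensional_comap (LinearMap.inl_injective (R := ℂ) (M := ℂ[X]) (M₂ := ℂ[X])) P
  have := finiteDimensional_comap (LinearMap.inr_injective (R := ℂ) (M := ℂ[X]) (M₂ := ℂ[X])) P
  obtain ⟨a, ha⟩ := exists_eq_degreeLT (P.comap (LinearMap.inl ℂ ℂ[X] ℂ[X])) fun p hp => by
    simpa using hP _ hp
  obtain ⟨b, hb⟩ := exists_eq_degreeLT (P.comap (LinearMap.inr ℂ ℂ[X] ℂ[X])) fun p hp => by
    simpa using hP _ hp
  obtain ⟨s, hs⟩ := exists_eq_degreeLT (P.map (LinearMap.fst ℂ ℂ[X] ℂ[X]))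
    (forall_apply_mem_map (f := derivative.prodMap derivative)
      (h := LinearMap.fst ℂ ℂ[X] ℂ[X]) (fun _ => rfl) hP)
  have has : a ≤ s := by
    by_contra! h
    have hmem : (X ^ s, 0) ∈ P := ha.ge (X_pow_mem_degreeLT.2 h)
    exact (X_pow_mem_degreeLT.1 (hs.le ⟨_, hmem, rfl⟩)).false
  obtain ⟨r, rfl⟩ := Nat.exists_eq_add_of_le has
  obtain ⟨c, hc⟩ := exists_X_pow_mixedPoly_mem hP ha.ge hb hs.ge
  refine ⟨a, b, r, c, fun hr hc0 => ?_, hb, eq_span_pairGens ha.ge hb hs.le hc⟩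
  have hmem := hc 0 hr
  rw [mixedPoly_zero, mixedCoeff_eq_mul, Nat.sub_zero, hc0, mul_zero, zero_smul] at hmem
  exact (X_pow_mem_degreeLT.1 (ha.le hmem)).false

theorem mixedCoeff_eq_zero_of_X_mul_derivative_mem
    (hE : ∀ x ∈ P, (X * derivative x.1, X * derivative x.2) ∈ P)
    (hinr : P.comap (LinearMap.inr ℂ ℂ[X] ℂ[X]) ≤ degreeLT ℂ b) {k j : ℕ}
    (hk : (X ^ (a + k), mixedPoly a b c k) ∈ P) (hj : j ≤ k) (hne : b + j ≠ a + k) :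
    mixedCoeff a b c k j = 0 := by
  have hmem : X * derivative (mixedPoly a b c k) - ((a + k : ℕ) : ℂ) • mixedPoly a b c k ∈
      degreeLT ℂ b := by
    refine hinr ?_
    have hsub := P.sub_mem (hE _ hk) (P.smul_mem ((a + k : ℕ) : ℂ) hk)
    rwa [X_mul_derivative_X_pow, Prod.smul_mk, Prod.mk_sub_mk, sub_self] at hsub
  have hcoeff : ∀ (p : ℂ[X]) (n : ℕ), (X * derivative p).coeff n = n * p.coeff n := by
    rintro p (_ | n)
    · simp
    · simp [coeff_X_mul, coeff_derivative, mul_comm]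
  have hzero := mem_degreeLT_iff_coeff.1 hmem (b + j) (Nat.le_add_right b j)
  rw [coeff_sub, coeff_smul, hcoeff, coeff_mixedPoly, if_pos hj, smul_eq_mul, ← sub_mul] at hzero
  exact (mul_eq_zero.1 hzero).resolve_left (sub_ne_zero.2 (Nat.cast_injective.ne hne))

theorem exists_eq_span_pairGens_monomial (P : Submodule ℂ (ℂ[X] × ℂ[X])) [FiniteDimensional ℂ P]
    (hP : ∀ x ∈ P, (derivative x.1, derivative x.2) ∈ P)
    (hE : ∀ x ∈ P, (X * derivative x.1, X * derivative x.2) ∈ P) :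
    ∃ (a b r : ℕ) (c : ℂ), c ≠ 0 ∧ (1 ≤ r → a = b) ∧ P = Submodule.span ℂ
      (pairGens a b r fun k => mixedCoeff a b (fun _ => c) k k • X ^ (b + k)) := by
  obtain ⟨a, b, r, c, hc, hinr, hspan⟩ := exists_eq_span_pairGens_mixedPoly P hP
  rcases Nat.eq_zero_or_pos r with rfl | hr
  · exact ⟨a, b, 0, 1, one_ne_zero, by simp, by simpa [pairGens] using hspan⟩
  have hmem := (span_pairGens_le.1 hspan.ge).2.2
  obtain rfl : a = b := by
    by_contra hab
    exact mixedCoeff_ne_zero a b (hc hr) (mixedCoeff_eq_zero_of_X_mul_derivative_mem hE hinr.le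
      (hmem 0 hr) le_rfl (Ne.symm hab))
  have hmixed : ∀ k < r, mixedPoly a a c k = mixedCoeff a a (fun _ => c 0) k k • X ^ (a + k) := by
    intro k hk
    rw [mixedPoly, Finset.sum_eq_single_of_mem k (by simp), mixedCoeff_eq_mul _ _ c,
      mixedCoeff_eq_mul _ _ fun _ => c 0, Nat.sub_self]
    intro j hj hjk
    have hj' : j < k := lt_of_le_of_ne (Nat.lt_succ_iff.1 (Finset.mem_range.1 hj)) hjk
    rw [mixedCoeff_eq_zero_of_X_mul_derivative_mem hE hinr.le (hmem k hk) hj'.le (by omega),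
      zero_smul]
  refine ⟨a, a, r, c 0, hc hr, fun _ => rfl, hspan.trans (congrArg (Submodule.span ℂ) ?_)⟩
  unfold pairGens
  congr 1
  ext x
  exact exists_congr fun k => and_congr_right fun hk => by rw [hmixed k hk]

end PolynomialPairs

/-! ### Analytic functions -/

section AnalyticFunctions

theorem Hol.ext {f g : Hol U} (h : ∀ z : U, f.1 z = g.1 z) : f = g :=
  Subtype.ext (funext h)

theorem hasDerivAt_ext0 (f : Hol U) (z : U) : HasDerivAt (ext0 f.1) ((ddz U f).1 z) z :=
  (f.2 z z.2).differentiableAt.hasDerivAt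

theorem ddz_eq_of_hasDerivAt {f g : Hol U} {F : ℂ → ℂ} (hF : ∀ z : U, f.1 z = F z)
    (h : ∀ z : U, HasDerivAt F (g.1 z) z) : ddz U f = g :=
  Hol.ext fun z => (hasDerivAt_ext0 f z).unique
    ((h z).congr_of_eventuallyEq (ext0_eventuallyEq f.1 F hF z).symm)

theorem exists_eq_smul_one_of_ddz_eq_zero (hU : IsPreconnected (U : Set ℂ)) {f : Hol U}
    (hf : ddz U f = 0) : ∃ c : ℂ, f = c • (1 : Hol U) := by
  obtain ⟨c, hc⟩ := U.isOpen.exists_is_const_of_deriv_eq_zero hU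
    (fun z hz => (f.2 z hz).differentiableAt.differentiableWithinAt)
    (fun z hz => congrFun (congrArg Subtype.val hf) ⟨z, hz⟩)
  refine ⟨c, Hol.ext fun z => ?_⟩
  rw [← ext0_apply f.1 z, hc z z.2]
  simp

theorem ddz_mul_inv (g : Hol U) (u : (Hol U)ˣ) :
    ddz U (g * ↑u⁻¹) = (↑u⁻¹ : Hol U) ^ 2 * (u * ddz U g - g * ddz U (u : Hol U)) := by
  rw [Derivation.leibniz, Derivation.leibniz_of_mul_eq_one _ u.inv_mul, smul_eq_mul, smul_eq_mul,
    smul_eq_mul]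
  linear_combination -(↑u⁻¹ * ddz U g) * u.inv_mul

theorem exists_eq_smul_of_mul_ddz_eq (hU : IsPreconnected (U : Set ℂ)) {g : Hol U} (u : (Hol U)ˣ)
    (h : u * ddz U g = g * ddz U (u : Hol U)) : ∃ c : ℂ, g = c • (u : Hol U) := by
  obtain ⟨c, hc⟩ := exists_eq_smul_one_of_ddz_eq_zero hU (f := g * ↑u⁻¹) (by
    rw [ddz_mul_inv, h, sub_self, mul_zero])
  exact ⟨c, by rw [← u.inv_mul_cancel_right g, hc, smul_mul_assoc, one_mul]⟩

theorem isUnit_of_forall_ne_zero {f : Hol U} (hf : ∀ z : U, f.1 z ≠ 0) : IsUnit f := by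
  have hinv : AnalyticOnNhd ℂ (fun z => (ext0 f.1 z)⁻¹) U := fun z hz =>
    (f.2 z hz).inv (by rw [ext0_apply f.1 ⟨z, hz⟩]; exact hf _)
  refine IsUnit.of_mul_eq_one (Hol.mk _ hinv) (Hol.ext fun z => ?_)
  change f.1 z * (ext0 f.1 z)⁻¹ = 1
  rw [ext0_apply, mul_inv_cancel₀ (hf z)]

theorem apply_ne_zero_of_isUnit {f : Hol U} (hf : IsUnit f) (z : U) : f.1 z ≠ 0 :=
  (hf.map ((Pi.evalRingHom (fun _ : U => ℂ) z).comp (Hol U).subtype)).ne_zero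

/-- The exponential of an analytic function. -/
def Hol.exp (f : Hol U) : Hol U :=
  Hol.mk (fun z => Complex.exp (ext0 f.1 z)) fun z hz => (f.2 z hz).cexp

theorem Hol.exp_apply (f : Hol U) (z : U) : (Hol.exp f).1 z = Complex.exp (f.1 z) :=
  congrArg Complex.exp (ext0_apply f.1 z)

theorem isUnit_exp (f : Hol U) : IsUnit (Hol.exp f) :=
  isUnit_of_forall_ne_zero fun _ => Complex.exp_ne_zero _

theorem ddz_exp (f : Hol U) : ddz U (Hol.exp f) = Hol.exp f * ddz U f :=
  ddz_eq_of_hasDerivAt (F := fun z => Complex.exp (ext0 f.1 z)) (fun _ => rfl) fun z =>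
    (hasDerivAt_ext0 f z).cexp

theorem ddz_mon_one (U : Opens ℂ) : ddz U (mon U 1) = 1 :=
  ddz_eq_of_hasDerivAt (F := fun z => z ^ 1) (fun _ => rfl) fun z => by
    simp only [pow_one]
    exact hasDerivAt_id' (z : ℂ)

theorem mon_apply (k : ℕ) (z : U) : (mon U k).1 z = (z : ℂ) ^ k := rfl

theorem mon_eq_pow (U : Opens ℂ) (k : ℕ) : mon U k = mon U 1 ^ k :=
  Hol.ext fun z => by simp [mon_apply]

/-- Every analytic function on `U` has a primitive. -/
def HasPrimitives (U : Opens ℂ) : Prop := ∀ f : Hol U, ∃ F : Hol U, ddz U F = f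

/-- The open set `U` is a disc: the kind of domain onto which the local changes of variable of the
classification map, since discs are connected and carry primitives. -/
def IsDisc (U : Opens ℂ) : Prop := ∃ (c : ℂ) (r : ℝ), 0 < r ∧ (U : Set ℂ) = Metric.ball c r

theorem IsDisc.isConnected (hU : IsDisc U) : IsConnected (U : Set ℂ) := by
  obtain ⟨c, r, hr, h⟩ := hU
  exact h ▸ Metric.isConnected_ball hr

theorem IsDisc.hasPrimitives (hU : IsDisc U) : HasPrimitives U := by
  obtain ⟨c, r, -, h⟩ := hU
  intro f
  have hf : DifferentiableOn ℂ (ext0 f.1) (Metric.ball c r) := by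
    rw [← h]
    exact fun z hz => (f.2 z hz).differentiableAt.differentiableWithinAt
  obtain ⟨F, hF⟩ := hf.isExactOn_ball
  rw [← h] at hF
  have hF' : AnalyticOnNhd ℂ F U := DifferentiableOn.analyticOnNhd
    (fun z hz => (hF z hz).differentiableAt.differentiableWithinAt) U.isOpen
  refine ⟨Hol.mk F hF', ddz_eq_of_hasDerivAt (F := F) (fun _ => rfl) fun z => ?_⟩
  rw [← ext0_apply f.1 z]
  exact hF z z.2

/-- Polynomials as analytic functions. -/
def polyHol (U : Opens ℂ) : ℂ[X] →ₐ[ℂ] Hol U := aeval (mon U 1)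

theorem polyHol_X (U : Opens ℂ) : polyHol U X = mon U 1 := aeval_X _

theorem polyHol_X_pow (U : Opens ℂ) (k : ℕ) : polyHol U (X ^ k) = mon U k := by
  rw [map_pow, polyHol_X, ← mon_eq_pow]

theorem ddz_polyHol (p : ℂ[X]) : ddz U (polyHol U p) = polyHol U (derivative p) := by
  rw [polyHol, Derivation.map_aeval, ddz_mon_one, smul_eq_mul, mul_one]

theorem polyHol_apply (p : ℂ[X]) (z : U) : (polyHol U p).1 z = p.eval (z : ℂ) := by
  have h := hom_eval₂ p (algebraMap ℂ (Hol U))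
    ((Pi.evalRingHom (fun _ : U => ℂ) z).comp (Hol U).subtype) (mon U 1)
  refine h.trans ?_
  simp only [eval]
  congr 1
  simp [mon_apply]

theorem polyHol_injective (hU : (U : Set ℂ).Nonempty) : Function.Injective (polyHol U) := by
  rw [injective_iff_map_eq_zero]
  intro p hp
  have hinf : (U : Set ℂ).Infinite :=
    infinite_of_mem_nhds hU.some (U.isOpen.mem_nhds hU.some_mem)
  refine p.eq_zero_of_infinite_isRoot (hinf.mono fun z hz => ?_)
  rw [Set.mem_ofPred_eq, IsRoot, ← polyHol_apply p ⟨z, hz⟩, hp]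
  rfl

end AnalyticFunctions

section QuasiPolynomials

/-- The quasi-polynomial `e^{μz} p(z)`. -/
def expPoly (U : Opens ℂ) (μ : ℂ) : ℂ[X] →ₗ[ℂ] Hol U :=
  LinearMap.mulLeft ℂ (Hol.exp (μ • mon U 1)) ∘ₗ (polyHol U).toLinearMap

theorem expPoly_apply (μ : ℂ) (p : ℂ[X]) :
    expPoly U μ p = Hol.exp (μ • mon U 1) * polyHol U p := rfl

theorem expPoly_X_pow (μ : ℂ) (k : ℕ) : expPoly U μ (X ^ k) = expMon U μ k := by
  rw [expPoly_apply, polyHol_X_pow, mul_comm]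
  refine Hol.ext fun z => congrArg ((z : ℂ) ^ k * ·) ((Hol.exp_apply _ z).trans ?_)
  exact congrArg (fun w => Complex.exp (μ * w)) (pow_one (z : ℂ))

theorem expPoly_zero_apply (p : ℂ[X]) : expPoly U 0 p = polyHol U p := by
  have hexp : Hol.exp (0 : Hol U) = 1 :=
    Hol.ext fun z => (Hol.exp_apply 0 z).trans Complex.exp_zero
  rw [expPoly_apply, zero_smul, hexp, one_mul]

theorem expPoly_X_mul (μ : ℂ) (p : ℂ[X]) : expPoly U μ (X * p) = mon U 1 * expPoly U μ p := by
  rw [expPoly_apply, expPoly_apply, map_mul, polyHol_X, mul_left_comm]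

theorem ddz_expPoly (μ : ℂ) (p : ℂ[X]) :
    ddz U (expPoly U μ p) = expPoly U μ (derivative p + μ • p) := by
  simp only [expPoly_apply, Derivation.leibniz, ddz_exp, ddz_polyHol, map_smul,
    Derivation.map_smul, ddz_mon_one, map_add, smul_eq_mul, smul_mul_assoc, mul_smul_comm, mul_one,
    mul_comm (polyHol U p)]

theorem expPoly_injective (hU : (U : Set ℂ).Nonempty) (μ : ℂ) :
    Function.Injective (expPoly U μ) := fun _ _ h =>
  polyHol_injective hU ((isUnit_exp (μ • mon U 1)).mul_left_cancel h)

theorem exists_expPoly_C_eq (hU : IsPreconnected (U : Set ℂ)) {f : Hol U} {μ : ℂ}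
    (hf : ddz U f = μ • f) : ∃ c : ℂ, expPoly U μ (C c) = f := by
  obtain ⟨u, hu⟩ := isUnit_exp (μ • mon U 1)
  have hu' : ddz U (u : Hol U) = μ • (u : Hol U) := by
    rw [hu, ddz_exp, Derivation.map_smul, ddz_mon_one, mul_smul_comm, mul_one]
  obtain ⟨c, hc⟩ := exists_eq_smul_of_mul_ddz_eq hU (g := f) u (by
    rw [hf, hu', mul_smul_comm, mul_smul_comm, mul_comm])
  refine ⟨c, ?_⟩
  rw [expPoly_apply, ← hu, ← mul_one (C c), ← smul_eq_C_mul, map_smul, map_one, mul_smul_comm,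
    mul_one, hc]

theorem maxGenEigenspace_ddz_le_range (hU : IsPreconnected (U : Set ℂ)) (μ : ℂ) :
    Module.End.maxGenEigenspace (ddz U : Hol U →ₗ[ℂ] Hol U) μ ≤ (expPoly U μ).range := by
  set D : Module.End ℂ (Hol U) := (ddz U : Hol U →ₗ[ℂ] Hol U) - μ • 1
  have hD : ∀ f, D f = ddz U f - μ • f := fun _ => rfl
  suffices h : ∀ (n : ℕ) (f : Hol U), (D ^ n) f = 0 → f ∈ (expPoly U μ).range by
    intro f hf
    obtain ⟨n, hn⟩ := (Module.End.mem_maxGenEigenspace _ _ _).1 hf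
    exact h n f hn
  intro n
  induction n with
  | zero => exact fun f hf => ⟨0, by simpa using hf.symm⟩
  | succ n ih =>
    intro f hf
    obtain ⟨p, hp⟩ := ih (D f) (by rwa [pow_succ, Module.End.mul_apply] at hf)
    obtain ⟨q, rfl⟩ := exists_derivative_eq p
    obtain ⟨c, hc⟩ := exists_expPoly_C_eq hU (f := f - expPoly U μ q) (μ := μ) (by
      rw [hD, eq_sub_iff_add_eq] at hp
      rw [map_sub, ddz_expPoly, ← hp, map_add, map_smul, smul_sub]
      abel)
    exact ⟨C c + q, by rw [map_add, hc, sub_add_cancel]⟩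

-- Without this shortcut, each `f • x` triggers a slow search through the subalgebra actions.
instance : SMul (Hol U) (SFun U) := Prod.instSMul

theorem dz_apply (x : SFun U) : dz U x = (ddz U x.1, ddz U x.2) := rfl

/-- The pair of quasi-polynomials `e^{μz} (p(z), q(z))`. -/
def expPair (U : Opens ℂ) (μ : ℂ) : ℂ[X] × ℂ[X] →ₗ[ℂ] SFun U :=
  (expPoly U μ).prodMap (expPoly U μ)

theorem expPair_apply (μ : ℂ) (x : ℂ[X] × ℂ[X]) :
    expPair U μ x = (expPoly U μ x.1, expPoly U μ x.2) := rfl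

theorem expPair_injective (hU : (U : Set ℂ).Nonempty) (μ : ℂ) :
    Function.Injective (expPair U μ) :=
  (expPoly_injective hU μ).prodMap (expPoly_injective hU μ)

theorem dz_expPair (μ : ℂ) (x : ℂ[X] × ℂ[X]) :
    dz U (expPair U μ x) = expPair U μ (derivative x.1 + μ • x.1, derivative x.2 + μ • x.2) := by
  simp only [dz_apply, expPair_apply, ddz_expPoly]

variable {A : Submodule ℂ (SFun U)}

theorem derivative_mem_comap_expPair (hA : ∀ x ∈ A, dz U x ∈ A) (μ : ℂ) :
    ∀ x ∈ A.comap (expPair U μ),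
      (derivative x.1, derivative x.2) ∈ A.comap (expPair U μ) := by
  intro x hx
  have hadd : (derivative x.1, derivative x.2) + μ • x ∈ A.comap (expPair U μ) := by
    rw [Submodule.mem_comap]
    exact dz_expPair μ x ▸ hA _ hx
  rwa [Submodule.add_mem_iff_left _ (Submodule.smul_mem _ μ hx)] at hadd

theorem le_iSup_map_expPair (hU : IsPreconnected (U : Set ℂ)) [FiniteDimensional ℂ A]
    (hA : ∀ x ∈ A, dz U x ∈ A) : A ≤ ⨆ μ, (A.comap (expPair U μ)).map (expPair U μ) := by
  refine (le_iSup_inf_maxGenEigenspace hA).trans (iSup_mono fun μ x hx => ?_)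
  obtain ⟨p, hp⟩ := maxGenEigenspace_ddz_le_range hU μ (apply_mem_maxGenEigenspace
    (g := (ddz U : Hol U →ₗ[ℂ] Hol U)) (h := LinearMap.fst ℂ _ _) (fun _ => rfl) hx.2)
  obtain ⟨q, hq⟩ := maxGenEigenspace_ddz_le_range hU μ (apply_mem_maxGenEigenspace
    (g := (ddz U : Hol U →ₗ[ℂ] Hol U)) (h := LinearMap.snd ℂ _ _) (fun _ => rfl) hx.2)
  have hpq : expPair U μ (p, q) = x := Prod.ext hp hq
  exact ⟨(p, q), by simpa [hpq] using hx.1, hpq⟩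

theorem exists_finset_eq_iSup_map_expPair (hU : IsPreconnected (U : Set ℂ))
    [FiniteDimensional ℂ A] (hA : ∀ x ∈ A, dz U x ∈ A) :
    ∃ M : Finset ℂ, A = ⨆ μ ∈ M, (A.comap (expPair U μ)).map (expPair U μ) := by
  have hcompact := (Submodule.fg_iff_compact A).1
    ((Submodule.fg_iff_finiteDimensional A).2 inferInstance)
  obtain ⟨M, hM⟩ := (CompleteLattice.isCompactElement_iff_exists_le_iSup_of_le_iSup A).1 hcompact
    ℂ _ (le_iSup_map_expPair hU hA)
  rw [Finset.sup_eq_iSup] at hM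
  exact ⟨M, le_antisymm hM (iSup₂_le fun μ _ => Submodule.map_comap_le _ _)⟩

theorem comap_expPair_eq_bot (hU : (U : Set ℂ).Nonempty) [FiniteDimensional ℂ A]
    (hA : ∀ x ∈ A, dz U x ∈ A) (hE : ∀ x ∈ A, mon U 1 • dz U x ∈ A) {μ : ℂ} (hμ : μ ≠ 0) :
    A.comap (expPair U μ) = ⊥ := by
  have := finiteDimensional_comap (expPair_injective hU μ) A
  set P := A.comap (expPair U μ)
  have hP := derivative_mem_comap_expPair hA μ
  have hX : ∀ x ∈ P, (X * (derivative x.1 + μ • x.1), X * (derivative x.2 + μ • x.2)) ∈ P := by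
    intro x hx
    have hmem := hE _ hx
    rw [dz_expPair] at hmem
    rw [Submodule.mem_comap, expPair_apply, expPoly_X_mul, expPoly_X_mul]
    exact hmem
  have hfst : P.map (LinearMap.fst ℂ _ _) = ⊥ := eq_bot_of_X_mul_derivative_add_mem _
    (by rintro _ ⟨x, hx, rfl⟩; exact ⟨_, hP x hx, rfl⟩) hμ
    (by rintro _ ⟨x, hx, rfl⟩; exact ⟨_, hX x hx, rfl⟩)
  have hsnd : P.map (LinearMap.snd ℂ _ _) = ⊥ := eq_bot_of_X_mul_derivative_add_mem _
    (by rintro _ ⟨x, hx, rfl⟩; exact ⟨_, hP x hx, rfl⟩) hμ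
    (by rintro _ ⟨x, hx, rfl⟩; exact ⟨_, hX x hx, rfl⟩)
  exact (Submodule.eq_bot_iff P).2 fun x hx => Prod.ext
    ((Submodule.eq_bot_iff _).1 hfst _ ⟨x, hx, rfl⟩)
    ((Submodule.eq_bot_iff _).1 hsnd _ ⟨x, hx, rfl⟩)

theorem eq_map_expPair_zero (hU : IsConnected (U : Set ℂ)) [FiniteDimensional ℂ A]
    (hA : ∀ x ∈ A, dz U x ∈ A) (hE : ∀ x ∈ A, mon U 1 • dz U x ∈ A) :
    A = (A.comap (expPair U 0)).map (expPair U 0) := by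
  refine le_antisymm ((le_iSup_map_expPair hU.isPreconnected hA).trans (iSup_le fun μ => ?_))
    (Submodule.map_comap_le _ _)
  rcases eq_or_ne μ 0 with rfl | hμ
  · exact le_rfl
  · rw [comap_expPair_eq_bot hU.nonempty hA hE hμ, Submodule.map_bot]
    exact bot_le

end QuasiPolynomials

/-! ### Even operators and their coefficients -/

section Coefficients

/-- The coefficients `(f, (g, h))` of an even operator `f ∂_z + g θ ∂_θ + h`. -/
abbrev Coeffs (U : Opens ℂ) : Type := Hol U × SFun U

/-- The even operator with given coefficients, as a linear map. -/
def evenHom (U : Opens ℂ) : Coeffs U →ₗ[ℂ] Module.End ℂ (SFun U) where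
  toFun t := evenOp t.1 t.2.1 t.2.2
  map_add' s t := LinearMap.ext fun F => by
    simp only [evenOp_apply, LinearMap.add_apply, Prod.fst_add, Prod.snd_add, Prod.mk_add_mk]
    refine Prod.ext ?_ ?_ <;> dsimp only <;> ring
  map_smul' c t := LinearMap.ext fun F => by
    simp only [evenOp_apply, LinearMap.smul_apply, Prod.smul_fst, Prod.smul_snd,
      Prod.smul_mk, smul_mul_assoc, smul_add, RingHom.id_apply]

/-- The multiplicative operator `g θ ∂_θ + h` as a linear function of `(g, h)`. -/
def aOpHom (U : Opens ℂ) : SFun U →ₗ[ℂ] Module.End ℂ (SFun U) :=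
  evenHom U ∘ₗ LinearMap.inr ℂ (Hol U) (SFun U)

theorem evenHom_apply (t : Coeffs U) : evenHom U t = evenOp t.1 t.2.1 t.2.2 := rfl

theorem aOpHom_apply (x : SFun U) : aOpHom U x = aOp x.1 x.2 := rfl

theorem evenHom_one_zero (U : Opens ℂ) : evenHom U (1, 0) = dz U :=
  LinearMap.ext fun F => by simp [evenHom_apply, evenOp_apply, dz_apply]

theorem evenHom_injective (U : Opens ℂ) : Function.Injective (evenHom U) := by
  rw [injective_iff_map_eq_zero]
  intro t ht
  have hone := LinearMap.congr_fun ht (1, 0)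
  have hz := LinearMap.congr_fun ht (mon U 1, 1)
  simp only [evenHom_apply, evenOp_apply, LinearMap.zero_apply, Derivation.map_one_eq_zero,
    mul_zero, zero_add, add_zero, mul_one, ddz_mon_one, Prod.mk_eq_zero, map_zero] at hone hz
  obtain ⟨hone, -⟩ := hone
  rw [hone, zero_mul, add_zero, add_zero] at hz
  exact Prod.ext hz.1 (Prod.ext hz.2 hone)

theorem dz_smul (f : Hol U) (x : SFun U) : dz U (f • x) = ddz U f • x + f • dz U x := by
  refine Prod.ext ?_ ?_ <;>
  · simp only [dz_apply, Prod.smul_fst, Prod.smul_snd, smul_eq_mul, Derivation.leibniz,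
      Prod.fst_add, Prod.snd_add]
    ring

/-- The coefficients of the commutator of two even operators. -/
def coeffsLie (s t : Coeffs U) : Coeffs U :=
  (s.1 * ddz U t.1 - t.1 * ddz U s.1, s.1 • dz U t.2 - t.1 • dz U s.2)

theorem lie_evenHom (s t : Coeffs U) : ⁅evenHom U s, evenHom U t⁆ = evenHom U (coeffsLie s t) :=
  evenOp_lie _ _ _ _ _ _

theorem lie_dz_aOpHom (x : SFun U) : ⁅dz U, aOpHom U x⁆ = aOpHom U (dz U x) := by
  have h := lie_evenHom ((1 : Hol U), (0 : SFun U)) (0, x)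
  rw [evenHom_one_zero] at h
  refine h.trans (congrArg (evenHom U) ?_)
  simp [coeffsLie]

/-- The operators with coefficients in `L` form a Lie algebra under the commutator. -/
def LieClosed (L : Submodule ℂ (Coeffs U)) : Prop :=
  ∀ s ∈ L, ∀ t ∈ L, coeffsLie s t ∈ L

/-- The action on coefficients of the gauge transformation by a factor `α` and of the change
`θ̄ = β θ`: the logarithmic derivatives of `α` and `β` determine `ξ`. -/
def gauge (ξ : SFun U) : Coeffs U →ₗ[ℂ] Coeffs U where
  toFun t := (t.1, t.2 + t.1 • ξ)
  map_add' s t := Prod.ext rfl (by simp only [Prod.fst_add, Prod.snd_add, add_smul]; abel)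
  map_smul' c t := Prod.ext rfl (by
    simp only [Prod.smul_fst, Prod.smul_snd, smul_add, smul_assoc, RingHom.id_apply])

theorem gauge_apply (ξ : SFun U) (t : Coeffs U) : gauge ξ t = (t.1, t.2 + t.1 • ξ) := rfl

theorem gauge_coeffsLie (ξ : SFun U) (s t : Coeffs U) :
    gauge ξ (coeffsLie s t) = coeffsLie (gauge ξ s) (gauge ξ t) := by
  refine Prod.ext rfl (Prod.ext ?_ ?_) <;>
  · simp only [gauge_apply, coeffsLie, map_add, Derivation.leibniz, dz_apply, Prod.smul_fst,
      Prod.smul_snd, Prod.fst_add, Prod.snd_add, Prod.fst_sub, Prod.snd_sub, smul_eq_mul]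
    ring

/-- The functions `f` for which `f ∂_z` is the vector field part of an operator with coefficients
in `L`. -/
def vectorFieldPart (L : Submodule ℂ (Coeffs U)) : Submodule ℂ (Hol U) :=
  L.map (LinearMap.fst ℂ (Hol U) (SFun U))

/-- The pairs `(g, h)` for which `L` contains the coefficients of `g θ ∂_θ + h`. -/
def multPart (L : Submodule ℂ (Coeffs U)) : Submodule ℂ (SFun U) :=
  L.comap (LinearMap.inr ℂ (Hol U) (SFun U))

variable {L : Submodule ℂ (Coeffs U)} {f : Hol U} {x y : SFun U}

theorem mem_vectorFieldPart : f ∈ vectorFieldPart L ↔ ∃ x, (f, x) ∈ L := by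
  simp [vectorFieldPart]

theorem mem_multPart : x ∈ multPart L ↔ ((0 : Hol U), x) ∈ L := Iff.rfl

instance [FiniteDimensional ℂ L] : FiniteDimensional ℂ (vectorFieldPart L) :=
  inferInstanceAs (FiniteDimensional ℂ (L.map (LinearMap.fst ℂ (Hol U) (SFun U))))

instance [FiniteDimensional ℂ L] : FiniteDimensional ℂ (multPart L) :=
  finiteDimensional_comap LinearMap.inr_injective L

theorem sub_mem_multPart (hx : (f, x) ∈ L) (hy : (f, y) ∈ L) : x - y ∈ multPart L := by
  simpa [mem_multPart] using L.sub_mem hx hy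

theorem add_mem_of_mem_multPart (hx : (f, x) ∈ L) (hy : y ∈ multPart L) : (f, x + y) ∈ L := by
  simpa using L.add_mem hx (mem_multPart.1 hy)

theorem mk_add_smul_mem_map_gauge (ξ : SFun U) (hx : (f, x) ∈ L) :
    (f, x + f • ξ) ∈ L.map (gauge ξ) := ⟨_, hx, rfl⟩

theorem vectorFieldPart_map_gauge (L : Submodule ℂ (Coeffs U)) (ξ : SFun U) :
    vectorFieldPart (L.map (gauge ξ)) = vectorFieldPart L :=
  (Submodule.map_comp _ _ L).symm

theorem LieClosed.map_gauge (hL : LieClosed L) (ξ : SFun U) : LieClosed (L.map (gauge ξ)) := by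
  rintro _ ⟨s, hs, rfl⟩ _ ⟨t, ht, rfl⟩
  exact ⟨_, hL s hs t ht, gauge_coeffsLie ξ s t⟩

theorem LieClosed.mul_ddz_sub_mem (hL : LieClosed L) :
    ∀ f ∈ vectorFieldPart L, ∀ g ∈ vectorFieldPart L,
      f * ddz U g - g * ddz U f ∈ vectorFieldPart L := by
  rintro _ ⟨s, hs, rfl⟩ _ ⟨t, ht, rfl⟩
  exact ⟨_, hL s hs t ht, rfl⟩

theorem LieClosed.smul_dz_mem (hL : LieClosed L) (hx : (f, x) ∈ L) :
    ∀ a ∈ multPart L, f • dz U a ∈ multPart L := fun a ha => by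
  simpa [mem_multPart, coeffsLie] using hL _ hx _ (mem_multPart.1 ha)

theorem LieClosed.dz_mem (hL : LieClosed L) (hx : ((1 : Hol U), x) ∈ L) :
    ∀ a ∈ multPart L, dz U a ∈ multPart L := by
  simpa only [one_smul] using hL.smul_dz_mem hx

theorem map_evenHom_eq {S : Set (Coeffs U)} (hS : S ⊆ L)
    (hfst : vectorFieldPart L ≤ Submodule.span ℂ (Prod.fst '' S)) :
    L.map (evenHom U) = Submodule.span ℂ (evenHom U '' S) ⊔ (multPart L).map (aOpHom U) := by
  have hdecomp : L = Submodule.span ℂ S ⊔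
      (multPart L).map (LinearMap.inr ℂ (Hol U) (SFun U)) := by
    refine eq_of_map_fst_le_of_comap_inr_le
      (sup_le (Submodule.span_le.2 hS) (Submodule.map_comap_le _ _)) ?_
      (Submodule.map_le_iff_le_comap.1 le_sup_right)
    rw [Submodule.map_sup, Submodule.map_span]
    exact hfst.trans le_sup_left
  conv_lhs => rw [hdecomp]
  rw [Submodule.map_sup, Submodule.map_span, ← Submodule.map_comp]
  rfl

end Coefficients

/-! ### Normal forms up to gauge -/

section MultiplicativePart

theorem aOpHom_expPair_X_pow_zero (μ : ℂ) (k : ℕ) :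
    aOpHom W (expPair W μ (X ^ k, 0)) = aOp (expMon W μ k) 0 := by
  rw [aOpHom_apply, expPair_apply, expPoly_X_pow, map_zero]

theorem aOpHom_expPair_zero_X_pow (μ : ℂ) (k : ℕ) :
    aOpHom W (expPair W μ (0, X ^ k)) = aOp 0 (expMon W μ k) := by
  rw [aOpHom_apply, expPair_apply, expPoly_X_pow, map_zero]

theorem expMon_zero (W : Opens ℂ) (k : ℕ) : expMon W 0 k = mon W k := by
  rw [← expPoly_X_pow, expPoly_zero_apply, polyHol_X_pow]

theorem bimodule_eq_iSup (M : Finset ℂ) (a b r : ℂ → ℕ) (c : ℂ → ℕ → ℂ) :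
    bimodule W M a b r c = ⨆ μ ∈ M,
      (Submodule.span ℂ (pairGens (a μ) (b μ) (r μ) (mixedPoly (a μ) (b μ) (c μ)))).map
        (aOpHom W ∘ₗ expPair W μ) := by
  have hmixed : ∀ μ k, aOpHom W (expPair W μ (X ^ (a μ + k), mixedPoly (a μ) (b μ) (c μ) k)) =
      aOp (expMon W μ (a μ + k)) (∑ j ∈ Finset.range (k + 1),
        mixedCoeff (a μ) (b μ) (c μ) k j • expMon W μ (b μ + j)) := fun μ k => by
    simp only [aOpHom_apply, expPair_apply, mixedPoly, map_sum, map_smul, expPoly_X_pow]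
  refine eq_of_forall_ge_iff fun N => ?_
  simp only [iSup_le_iff, Submodule.map_le_iff_le_comap, span_pairGens_le, Submodule.mem_comap,
    LinearMap.comp_apply, aOpHom_expPair_X_pow_zero, aOpHom_expPair_zero_X_pow, hmixed]
  simp only [bimodule, Submodule.span_le, Set.union_subset_iff, Set.ofPred_subset,
    SetLike.mem_coe, forall_exists_index, and_imp]
  exact ⟨fun ⟨⟨hg, hh⟩, hm⟩ μ hμ => ⟨fun k hk => hg _ μ hμ k hk rfl, fun k hk => hh _ μ hμ k hk rfl,
      fun k hk => hm _ μ hμ k hk rfl⟩,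
    fun h => ⟨⟨fun T μ hμ k hk hT => hT ▸ (h μ hμ).1 k hk,
      fun T μ hμ k hk hT => hT ▸ (h μ hμ).2.1 k hk⟩,
      fun T μ hμ k hk hT => hT ▸ (h μ hμ).2.2 k hk⟩⟩

theorem bimodule₀_eq_map (a b r : ℕ) (c : ℂ) :
    bimodule₀ W a b r c =
      (Submodule.span ℂ (pairGens a b r fun k => mixedCoeff a b (fun _ => c) k k • X ^ (b + k))).map
        (aOpHom W ∘ₗ expPair W 0) := by
  have hmixed : ∀ k, aOpHom W (expPair W 0
      (X ^ (a + k), mixedCoeff a b (fun _ => c) k k • X ^ (b + k))) = aOp (mon W (a + k))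
        ((((a + k).factorial * b.factorial : ℂ) / ((b + k).factorial * a.factorial) * c) •
          mon W (b + k)) := fun k => by
    simp only [aOpHom_apply, expPair_apply, map_smul, expPoly_X_pow, expMon_zero, mixedCoeff,
      Nat.add_sub_cancel]
  refine eq_of_forall_ge_iff fun N => ?_
  simp only [Submodule.map_le_iff_le_comap, span_pairGens_le, Submodule.mem_comap,
    LinearMap.comp_apply, aOpHom_expPair_X_pow_zero, aOpHom_expPair_zero_X_pow, hmixed,
    expMon_zero]
  simp only [bimodule₀, Submodule.span_le, Set.union_subset_iff, Set.ofPred_subset,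
    SetLike.mem_coe, forall_exists_index, and_imp]
  exact ⟨fun ⟨⟨hg, hh⟩, hm⟩ => ⟨fun k hk => hg _ k hk rfl, fun k hk => hh _ k hk rfl,
      fun k hk => hm _ k hk rfl⟩,
    fun ⟨hg, hh, hm⟩ => ⟨⟨fun T k hk hT => hT ▸ hg k hk, fun T k hk hT => hT ▸ hh k hk⟩,
      fun T k hk hT => hT ▸ hm k hk⟩⟩

variable {A : Submodule ℂ (SFun W)}

theorem X_pow_mul_derivative_mem_comap_expPair_zero {k : ℕ}
    (hE : ∀ x ∈ A, mon W k • dz W x ∈ A) :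
    ∀ x ∈ A.comap (expPair W 0),
      (X ^ k * derivative x.1, X ^ k * derivative x.2) ∈ A.comap (expPair W 0) := by
  intro x hx
  have hmem := hE _ hx
  rw [dz_expPair, zero_smul, zero_smul, add_zero, add_zero] at hmem
  rw [Submodule.mem_comap, expPair_apply]
  simp only [expPoly_zero_apply, map_mul, polyHol_X_pow]
  simp only [expPair_apply, expPoly_zero_apply] at hmem
  exact hmem

variable [FiniteDimensional ℂ A]

theorem exists_map_aOpHom_eq_bimodule (hW : IsConnected (W : Set ℂ))
    (hA : ∀ x ∈ A, dz W x ∈ A) :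
    ∃ (M : Finset ℂ) (a b r : ℂ → ℕ) (c : ℂ → ℕ → ℂ),
      (∀ μ, 0 < r μ → c μ 0 ≠ 0) ∧ A.map (aOpHom W) = bimodule W M a b r c := by
  have hfin : ∀ μ, FiniteDimensional ℂ (A.comap (expPair W μ)) := fun μ =>
    finiteDimensional_comap (expPair_injective hW.nonempty μ) A
  choose a b r c hc _ hspan using fun μ => exists_eq_span_pairGens_mixedPoly _
    (derivative_mem_comap_expPair hA μ)
  obtain ⟨M, hM⟩ := exists_finset_eq_iSup_map_expPair hW.isPreconnected hA
  refine ⟨M, a, b, r, c, hc, ?_⟩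
  conv_lhs => rw [hM]
  simp only [bimodule_eq_iSup, ← hspan, Submodule.map_iSup, Submodule.map_comp]

theorem isTranslationBimodule_map_aOpHom (hA : ∀ x ∈ A, dz W x ∈ A) :
    IsTranslationBimodule (A.map (aOpHom W)) := by
  refine ⟨inferInstance, ?_, ?_⟩
  · rintro _ ⟨x, -, rfl⟩
    exact ⟨x.1, x.2, rfl⟩
  · rintro _ ⟨x, hx, rfl⟩
    exact ⟨dz W x, hA x hx, (lie_dz_aOpHom x).symm⟩

theorem exists_map_aOpHom_eq_bimodule₀ (hW : IsConnected (W : Set ℂ))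
    (hA : ∀ x ∈ A, dz W x ∈ A) (hE : ∀ x ∈ A, mon W 1 • dz W x ∈ A) :
    ∃ (a b r : ℕ) (c : ℂ), c ≠ 0 ∧ (1 ≤ r → a = b) ∧
      A.map (aOpHom W) = bimodule₀ W a b r c := by
  have := finiteDimensional_comap (expPair_injective hW.nonempty 0) A
  obtain ⟨a, b, r, c, hc, hab, hspan⟩ := exists_eq_span_pairGens_monomial _
    (derivative_mem_comap_expPair hA 0) (by
      simpa only [pow_one] using X_pow_mul_derivative_mem_comap_expPair_zero hE)
  refine ⟨a, b, r, c, hc, hab, ?_⟩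
  conv_lhs => rw [eq_map_expPair_zero hW hA hE]
  rw [bimodule₀_eq_map, ← hspan, Submodule.map_comp]

theorem dz_eq_zero_of_mem (hW : IsConnected (W : Set ℂ)) (hA : ∀ x ∈ A, dz W x ∈ A)
    (hE : ∀ x ∈ A, mon W 1 • dz W x ∈ A) (hsq : ∀ x ∈ A, mon W 2 • dz W x ∈ A) :
    ∀ x ∈ A, dz W x = 0 := by
  have := finiteDimensional_comap (expPair_injective hW.nonempty 0) A
  set P := A.comap (expPair W 0)
  have hP := derivative_mem_comap_expPair hA 0
  have hX := X_pow_mul_derivative_mem_comap_expPair_zero hsq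
  have hfst : P.map (LinearMap.fst ℂ _ _) ≤ degreeLT ℂ 1 :=
    le_degreeLT_one_of_X_sq_mul_derivative_mem _
      (by rintro _ ⟨x, hx, rfl⟩; exact ⟨_, hP x hx, rfl⟩)
      (by rintro _ ⟨x, hx, rfl⟩; exact ⟨_, hX x hx, rfl⟩)
  have hsnd : P.map (LinearMap.snd ℂ _ _) ≤ degreeLT ℂ 1 :=
    le_degreeLT_one_of_X_sq_mul_derivative_mem _
      (by rintro _ ⟨x, hx, rfl⟩; exact ⟨_, hP x hx, rfl⟩)
      (by rintro _ ⟨x, hx, rfl⟩; exact ⟨_, hX x hx, rfl⟩)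
  have hder : ∀ p ∈ degreeLT ℂ 1, derivative p = 0 := fun p hp => by
    simpa [degreeLT_zero_eq_bot] using derivative_mem_degreeLT.2 hp
  intro x hx
  rw [eq_map_expPair_zero hW hA hE] at hx
  obtain ⟨q, hq, rfl⟩ := hx
  rw [dz_expPair, hder q.1 (hfst ⟨q, hq, rfl⟩), hder q.2 (hsnd ⟨q, hq, rfl⟩)]
  simp [expPair_apply]

theorem exists_mem_dz_smul_eq (hW : IsConnected (W : Set ℂ)) (hA : ∀ x ∈ A, dz W x ∈ A)
    (hE : ∀ x ∈ A, mon W 1 • dz W x ∈ A) : ∀ y ∈ A, ∃ x ∈ A, dz W (mon W 1 • x) = y := by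
  have hpoly : ∀ p : ℂ[X], derivative (X * p) = 0 → p = 0 := fun p hp => by
    have hC := derivative_eq_zero.1 hp
    by_contra hp0
    rw [natDegree_X_mul hp0] at hC
    omega
  refine exists_mem_apply_eq (f := dz W * mulBy (mon W 1)) (fun x hx => ?_) fun x hx h0 => ?_
  · rw [Module.End.mul_apply, show mulBy (mon W 1) x = mon W 1 • x from rfl, dz_smul, ddz_mon_one,
      one_smul]
    exact A.add_mem hx (hE x hx)
  · rw [eq_map_expPair_zero hW hA hE] at hx
    obtain ⟨q, -, rfl⟩ := hx
    have h : expPair W 0 (derivative (X * q.1), derivative (X * q.2)) = 0 := by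
      refine Eq.trans ?_ h0
      rw [Module.End.mul_apply, show mulBy (mon W 1) (expPair W 0 q) =
        expPair W 0 (X * q.1, X * q.2) by
          rw [expPair_apply, expPair_apply, expPoly_X_mul, expPoly_X_mul]; rfl,
        dz_expPair, zero_smul, zero_smul, add_zero, add_zero]
    have hq := (injective_iff_map_eq_zero _).1 (expPair_injective hW.nonempty 0) _ h
    have hq0 : q = 0 :=
      Prod.ext (hpoly _ (congrArg Prod.fst hq)) (hpoly _ (congrArg Prod.snd hq))
    rw [hq0, map_zero]

end MultiplicativePart

section NormalForms

/-- Pairs of constants as pairs of analytic functions. -/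
def constPair (W : Opens ℂ) : ℂ × ℂ →ₗ[ℂ] SFun W :=
  (LinearMap.toSpanSingleton ℂ (Hol W) 1).prodMap (LinearMap.toSpanSingleton ℂ (Hol W) 1)

theorem constPair_apply (c : ℂ × ℂ) : constPair W c = (c.1 • 1, c.2 • 1) := rfl

theorem exists_constPair_eq_of_dz_eq_zero (hW : IsPreconnected (W : Set ℂ)) {x : SFun W}
    (hx : dz W x = 0) : ∃ c, constPair W c = x := by
  obtain ⟨α, hα⟩ := exists_eq_smul_one_of_ddz_eq_zero hW (congrArg Prod.fst hx)
  obtain ⟨β, hβ⟩ := exists_eq_smul_one_of_ddz_eq_zero hW (congrArg Prod.snd hx)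
  exact ⟨(α, β), Prod.ext hα.symm hβ.symm⟩

theorem ddz_mon_two (W : Opens ℂ) : ddz W (mon W 2) = (2 : ℂ) • mon W 1 := by
  rw [mon_eq_pow W 2, Derivation.leibniz_pow, ddz_mon_one]
  simp [two_smul]

variable {L : Submodule ℂ (Coeffs W)}

theorem LieClosed.exists_mem_of_mon_two_mem (hL : LieClosed L)
    (hconst : ∀ x ∈ multPart L, dz W x = 0) (hone : ((1 : Hol W), (0 : SFun W)) ∈ L)
    {κ : SFun W} (hz : (mon W 1, κ) ∈ L) (hκ : dz W κ = 0)
    (hsq : mon W 2 ∈ vectorFieldPart L) :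
    ∃ η, dz W η = 0 ∧ (mon W 1, η) ∈ L ∧ (mon W 2, (2 : ℂ) • mon W 1 • η) ∈ L := by
  obtain ⟨ζ, hζ⟩ := mem_vectorFieldPart.1 hsq
  obtain ⟨η, hη⟩ : ∃ η, dz W ζ = (2 : ℂ) • η := ⟨(2⁻¹ : ℂ) • dz W ζ, by simp [smul_smul]⟩
  have hzη : (mon W 1, η) ∈ L := by
    have h : ((2 : ℂ) • (mon W 1, η)) ∈ L := by
      simpa [coeffsLie, ddz_mon_two, hη] using hL _ hone _ hζ
    simpa [smul_smul] using L.smul_mem (2⁻¹ : ℂ) h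
  have hη0 : dz W η = 0 := by
    simpa only [map_sub, hκ, sub_zero] using hconst _ (sub_mem_multPart hzη hz)
  refine ⟨η, hη0, hzη, ?_⟩
  convert hL _ hzη _ hζ using 1
  refine Prod.ext ?_ ?_
  · change mon W 2 = mon W 1 * ddz W (mon W 2) - mon W 2 * ddz W (mon W 1)
    rw [ddz_mon_two, ddz_mon_one, mon_eq_pow W 2, two_smul]
    ring
  · rw [coeffsLie, hη0, hη, smul_zero, sub_zero, smul_comm]

variable [FiniteDimensional ℂ L]

theorem isForm1_of_mem (hW : IsConnected (W : Set ℂ)) (hL : LieClosed L)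
    (hone : ((1 : Hol W), (0 : SFun W)) ∈ L)
    (hfst : vectorFieldPart L ≤ Submodule.span ℂ {1}) : IsForm1 (L.map (evenHom W)) := by
  have hdz := hL.dz_mem hone
  obtain ⟨M, a, b, r, c, hc, hM⟩ := exists_map_aOpHom_eq_bimodule hW hdz
  refine ⟨M, a, b, r, c, fun μ _ => hc μ, hM ▸ isTranslationBimodule_map_aOpHom hdz, ?_⟩
  rw [map_evenHom_eq (S := {(1, 0)}) (by simpa using hone) (by simpa using hfst), hM,
    Set.image_singleton, evenHom_one_zero]

theorem isForm2_of_mem (hW : IsConnected (W : Set ℂ)) (hL : LieClosed L)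
    (hone : ((1 : Hol W), (0 : SFun W)) ∈ L) {κ : SFun W} (hz : (mon W 1, κ) ∈ L)
    (hκ : dz W κ = 0) (hfst : vectorFieldPart L ≤ Submodule.span ℂ {1, mon W 1}) :
    IsForm2 (L.map (evenHom W)) := by
  obtain ⟨⟨α, β⟩, rfl⟩ := exists_constPair_eq_of_dz_eq_zero hW.isPreconnected hκ
  obtain ⟨a, b, r, c, hc, hab, hA⟩ :=
    exists_map_aOpHom_eq_bimodule₀ hW (hL.dz_mem hone) (hL.smul_dz_mem hz)
  refine ⟨α, β, c, a, b, r, hc, hab, ?_⟩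
  rw [map_evenHom_eq (S := {(1, 0), (mon W 1, constPair W (α, β))}) ?_ ?_, hA, Set.image_pair,
    evenHom_one_zero]
  · rfl
  · exact Set.insert_subset hone (Set.singleton_subset_iff.2 hz)
  · rwa [Set.image_pair]

theorem isForm3_of_mem (hW : IsConnected (W : Set ℂ)) (hL : LieClosed L)
    (hone : ((1 : Hol W), (0 : SFun W)) ∈ L) {κ : SFun W} (hz : (mon W 1, κ) ∈ L)
    (hκ : dz W κ = 0) (hfst : vectorFieldPart L = Submodule.span ℂ {1, mon W 1, mon W 2}) :
    IsForm3 (L.map (evenHom W)) := by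
  have hsq : mon W 2 ∈ vectorFieldPart L := hfst ▸ Submodule.subset_span (by simp)
  have hconst : ∀ x ∈ multPart L, dz W x = 0 := by
    obtain ⟨ζ, hζ⟩ := mem_vectorFieldPart.1 hsq
    exact dz_eq_zero_of_mem hW (hL.dz_mem hone) (hL.smul_dz_mem hz) (hL.smul_dz_mem hζ)
  obtain ⟨η, hη, hzη, hsqη⟩ := hL.exists_mem_of_mon_two_mem hconst hone hz hκ hsq
  obtain ⟨⟨α, β⟩, rfl⟩ := exists_constPair_eq_of_dz_eq_zero hW.isPreconnected hη
  obtain ⟨γ, S, hS, hspan⟩ := exists_subset_pair_span_eq ((multPart L).comap (constPair W))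
  have hmult : multPart L = (Submodule.span ℂ S).map (constPair W) := by
    rw [hspan, Submodule.map_comap_eq_of_le]
    exact fun x hx => exists_constPair_eq_of_dz_eq_zero hW.isPreconnected (hconst x hx)
  have hsqη' : (2 : ℂ) • mon W 1 • constPair W (α, β) = ((2 * α) • mon W 1, (2 * β) • mon W 1) :=
    Prod.ext (by simp [constPair_apply, smul_smul]) (by simp [constPair_apply, smul_smul])
  refine ⟨α, β, γ, (aOpHom W ∘ₗ constPair W) '' S, ?_, ?_⟩
  · rintro _ ⟨x, hx, rfl⟩
    rcases hS hx with rfl | rfl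
    · left; simp [constPair_apply, aOpHom_apply]
    · right; simp [constPair_apply, aOpHom_apply]
  · rw [map_evenHom_eq (S := {(1, 0), (mon W 1, constPair W (α, β)),
      (mon W 2, ((2 * α) • mon W 1, (2 * β) • mon W 1))}) ?_ ?_, hmult, ← Submodule.map_comp,
      Submodule.map_span, Submodule.span_union, Set.image_insert_eq, Set.image_pair,
      evenHom_one_zero]
    · rfl
    · rw [← hsqη']
      exact Set.insert_subset hone (Set.insert_subset hzη (Set.singleton_subset_iff.2 hsqη))
    · rw [Set.image_insert_eq, Set.image_pair, hfst]

theorem exists_gauge (hW : IsConnected (W : Set ℂ)) (hL : LieClosed L)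
    (hone : 1 ∈ vectorFieldPart L) (hz : mon W 1 ∈ vectorFieldPart L) :
    ∃ ξ κ : SFun W, dz W κ = 0 ∧ ((1 : Hol W), (0 : SFun W)) ∈ L.map (gauge ξ) ∧
      (mon W 1, κ) ∈ L.map (gauge ξ) := by
  obtain ⟨x, hx⟩ := mem_vectorFieldPart.1 hone
  obtain ⟨y, hy⟩ := mem_vectorFieldPart.1 hz
  have hmem : dz W (y - mon W 1 • x) ∈ multPart L := by
    have h : ((1 : Hol W), dz W y - mon W 1 • dz W x) ∈ L := by
      simpa [coeffsLie, ddz_mon_one] using hL _ hx _ hy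
    convert sub_mem_multPart h hx using 1
    rw [map_sub, dz_smul, ddz_mon_one, one_smul]
    abel
  obtain ⟨v, hv, hdv⟩ := exists_mem_dz_smul_eq hW (hL.dz_mem hx) (hL.smul_dz_mem hy) _ hmem
  refine ⟨-(x + v), y + mon W 1 • -(x + v), ?_, ?_, mk_add_smul_mem_map_gauge _ hy⟩
  · rw [show y + mon W 1 • -(x + v) = (y - mon W 1 • x) - mon W 1 • v by
      rw [smul_neg, smul_add]; abel, map_sub, hdv, sub_self]
  · simpa using mk_add_smul_mem_map_gauge (-(x + v)) (add_mem_of_mem_multPart hx hv)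

theorem eq_span_mon_of_mul_ddz_sub_mem (hW : IsConnected (W : Set ℂ)) {F : Submodule ℂ (Hol W)}
    [FiniteDimensional ℂ F] (hone : 1 ∈ F) (hz : mon W 1 ∈ F)
    (hF : ∀ f ∈ F, ∀ g ∈ F, f * ddz W g - g * ddz W f ∈ F) :
    F = Submodule.span ℂ {1, mon W 1} ∨ F = Submodule.span ℂ {1, mon W 1, mon W 2} := by
  have hpoly : F = (F.comap (polyHol W).toLinearMap).map (polyHol W).toLinearMap := by
    refine le_antisymm (fun f hf => ?_) (Submodule.map_comap_le _ _)
    have hpair := eq_map_expPair_zero hW (A := F.map (LinearMap.inl ℂ (Hol W) (Hol W)))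
      (by
        rintro _ ⟨g, hg, rfl⟩
        exact ⟨ddz W g, by simpa using hF _ hone g hg, by simp [dz_apply]⟩)
      (by
        rintro _ ⟨g, hg, rfl⟩
        refine ⟨mon W 1 * ddz W g, ?_, by simp [dz_apply]⟩
        simpa [ddz_mon_one] using F.add_mem (hF _ hz g hg) hg)
    obtain ⟨q, -, hq⟩ := hpair.le ⟨f, hf, rfl⟩
    have hqf : polyHol W q.1 = f := (expPoly_zero_apply q.1).symm.trans (congrArg Prod.fst hq)
    exact ⟨q.1, by rwa [SetLike.mem_coe, Submodule.mem_comap, AlgHom.toLinearMap_apply, hqf], hqf⟩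
  have := finiteDimensional_comap (f := (polyHol W).toLinearMap) (polyHol_injective hW.nonempty) F
  have hmap : ∀ n, (degreeLT ℂ n).map (polyHol W).toLinearMap =
      Submodule.span ℂ (mon W '' Finset.range n) := fun n => by
    classical
    simp only [degreeLT_eq_span_X_pow, Submodule.map_span, Finset.coe_image, ← Set.image_comp,
      Function.comp_def, AlgHom.toLinearMap_apply, polyHol_X_pow]
  have hzero : mon W 0 = 1 := by rw [mon_eq_pow, pow_zero]
  rw [hpoly]
  rcases eq_degreeLT_two_or_three_of_wronskian_mem (F.comap (polyHol W).toLinearMap)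
    (by simpa using hone) (by simpa [polyHol_X] using hz)
    (fun p hp q hq => by simpa [wronskian, ddz_polyHol, mul_comm] using hF _ hp _ hq) with h | h
  · left
    rw [h, hmap, show (Finset.range 2 : Set ℕ) = {0, 1} by ext; simp; omega, Set.image_pair, hzero]
  · right
    rw [h, hmap, show (Finset.range 3 : Set ℕ) = {0, 1, 2} by ext; simp; omega,
      Set.image_insert_eq, Set.image_pair, hzero]

theorem exists_gauge_isForm (hW : IsConnected (W : Set ℂ)) (hL : LieClosed L)
    (hone : 1 ∈ vectorFieldPart L)
    (hfst : vectorFieldPart L ≤ Submodule.span ℂ {1} ∨ mon W 1 ∈ vectorFieldPart L) :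
    ∃ ξ : SFun W, IsForm1 ((L.map (gauge ξ)).map (evenHom W)) ∨
      IsForm2 ((L.map (gauge ξ)).map (evenHom W)) ∨
      IsForm3 ((L.map (gauge ξ)).map (evenHom W)) := by
  rcases hfst with hfst | hz
  · obtain ⟨x, hx⟩ := mem_vectorFieldPart.1 hone
    have hx' : ((1 : Hol W), (0 : SFun W)) ∈ L.map (gauge (-x)) := by
      simpa using mk_add_smul_mem_map_gauge (-x) hx
    exact ⟨-x, .inl (isForm1_of_mem hW (hL.map_gauge _) hx'
      (by rwa [vectorFieldPart_map_gauge]))⟩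
  · obtain ⟨ξ, κ, hκ, hone', hz'⟩ := exists_gauge hW hL hone hz
    refine ⟨ξ, .inr ?_⟩
    rcases eq_span_mon_of_mul_ddz_sub_mem hW hone hz hL.mul_ddz_sub_mem with h | h <;>
      rw [← vectorFieldPart_map_gauge L ξ] at h
    · exact .inl (isForm2_of_mem hW (hL.map_gauge _) hone' hz' hκ h.le)
    · exact .inr (isForm3_of_mem hW (hL.map_gauge _) hone' hz' hκ h)

end NormalForms

/-! ### Straightening vector fields -/

section Straightening

theorem exists_ddz_mul_eq_one_of_bracket_eq_smul {g : Hol U} {c : ℂ} (hc : c ≠ 0) (u : (Hol U)ˣ)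
    (h : u * ddz U g - g * ddz U (u : Hol U) = c • (u : Hol U)) :
    ∃ φ : Hol U, ddz U φ * u = 1 ∧ φ * u = c⁻¹ • g := by
  refine ⟨c⁻¹ • (g * ↑u⁻¹), ?_, by rw [smul_mul_assoc, u.inv_mul_cancel_right]⟩
  rw [Derivation.map_smul, ddz_mul_inv, h, mul_smul_comm, smul_smul, inv_mul_cancel₀ hc, one_smul]
  linear_combination (↑u⁻¹ * (u : Hol U) + 1) * u.inv_mul

theorem isUnit_of_bracket_eq_smul (hU : IsPreconnected (U : Set ℂ)) (hprim : HasPrimitives U)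
    (u : (Hol U)ˣ) {g : Hol U} (hg : g ≠ 0) {c : ℂ}
    (h : u * ddz U g - g * ddz U (u : Hol U) = c • g) : IsUnit g := by
  obtain ⟨ψ, hψ⟩ := hprim ↑u⁻¹
  obtain ⟨e, he⟩ := isUnit_exp (c • ψ)
  have hde : ddz U (e : Hol U) = e * (c • ↑u⁻¹) := by
    rw [he, ddz_exp, Derivation.map_smul, hψ]
  -- Along the flow of `u ∂_z`, whose time is `ψ`, the field `g ∂_z` grows like `exp (c ψ)`.
  obtain ⟨k, rfl⟩ := exists_eq_smul_of_mul_ddz_eq hU (g := g) (u * e) (by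
    rw [Units.val_mul, Derivation.leibniz, hde, smul_eq_mul, smul_eq_mul]
    simp only [Algebra.smul_def] at h ⊢
    linear_combination (e : Hol U) * h - g * e * algebraMap ℂ (Hol U) c * u.mul_inv)
  have hk : k ≠ 0 := fun hk => hg (by rw [hk, zero_smul])
  rw [← Units.smul_mk0 hk]
  exact (u * e).isUnit.smul (Units.mk0 k hk)

theorem exists_straightening (hU : IsPreconnected (U : Set ℂ)) (hprim : HasPrimitives U)
    {F : Submodule ℂ (Hol U)} [FiniteDimensional ℂ F]
    (hF : ∀ f ∈ F, ∀ g ∈ F, f * ddz U g - g * ddz U f ∈ F) {u : (Hol U)ˣ} (hu : (u : Hol U) ∈ F) :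
    ∃ φ f : Hol U, f ∈ F ∧ ddz U φ * f = 1 ∧ (F ≤ Submodule.span ℂ {f} ∨ φ * f ∈ F) := by
  by_cases hle : F ≤ Submodule.span ℂ {(u : Hol U)}
  · obtain ⟨φ, hφ⟩ := hprim ↑u⁻¹
    exact ⟨φ, u, hu, by rw [hφ, u.inv_mul], Or.inl hle⟩
  let ad : Module.End ℂ (Hol U) :=
    LinearMap.mulLeft ℂ (u : Hol U) ∘ₗ (ddz U : Hol U →ₗ[ℂ] Hol U) -
      LinearMap.mulRight ℂ (ddz U (u : Hol U))
  have had : ∀ f, ad f = u * ddz U f - f * ddz U (u : Hol U) := fun _ => rfl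
  obtain ⟨g, hg, hgu, ⟨c, hc, hgc⟩ | ⟨c, hgc⟩⟩ := exists_apply_eq_smul_or_apply_eq_smul (f := ad)
    (hF u hu) hu (by rw [had, sub_self]) hle
  · obtain ⟨v, rfl⟩ := isUnit_of_bracket_eq_smul hU hprim u
      (ne_of_mem_of_not_mem (Submodule.zero_mem _) hgu).symm hgc
    obtain ⟨φ, hφ, hφv⟩ := exists_ddz_mul_eq_one_of_bracket_eq_smul (neg_ne_zero.2 hc) v
      (g := (u : Hol U)) (by rw [neg_smul, ← hgc, had, neg_sub])
    exact ⟨φ, v, hg, hφ, Or.inr (hφv ▸ F.smul_mem _ hu)⟩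
  · have hc : c ≠ 0 := by
      rintro rfl
      rw [zero_smul, had, sub_eq_zero] at hgc
      obtain ⟨k, rfl⟩ := exists_eq_smul_of_mul_ddz_eq hU u hgc
      exact hgu (Submodule.smul_mem _ k (Submodule.mem_span_singleton_self _))
    obtain ⟨φ, hφ, hφu⟩ := exists_ddz_mul_eq_one_of_bracket_eq_smul hc u hgc
    exact ⟨φ, u, hu, hφ, Or.inr (hφu ▸ F.smul_mem _ hg)⟩

end Straightening

/-! ### Changes of variable -/

section Restriction

theorem res_apply (hVU : V ≤ U) (f : Hol U) (z : V) : (res hVU f).1 z = f.1 ⟨z, hVU z.2⟩ :=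
  ext0_apply f.1 ⟨z, hVU z.2⟩

/-- Restriction as a homomorphism of algebras. -/
def resHom (hVU : V ≤ U) : Hol U →ₐ[ℂ] Hol V where
  toFun := res hVU
  map_one' := Hol.ext (res_apply hVU 1)
  map_mul' f g := Hol.ext fun z => by
    rw [res_apply]
    exact congrArg₂ (· * ·) (res_apply hVU f z).symm (res_apply hVU g z).symm
  map_zero' := Hol.ext (res_apply hVU 0)
  map_add' f g := Hol.ext fun z => by
    rw [res_apply]
    exact congrArg₂ (· + ·) (res_apply hVU f z).symm (res_apply hVU g z).symm
  commutes' c := Hol.ext (res_apply hVU (algebraMap ℂ (Hol U) c))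

theorem resHom_apply (hVU : V ≤ U) (f : Hol U) : resHom hVU f = res hVU f := rfl

theorem ddz_resHom (hVU : V ≤ U) (f : Hol U) : ddz V (resHom hVU f) = resHom hVU (ddz U f) :=
  ddz_eq_of_hasDerivAt (F := ext0 f.1) (fun _ => rfl) fun z => by
    rw [resHom_apply, res_apply]
    exact hasDerivAt_ext0 f ⟨z, hVU z.2⟩

theorem map_resHom_map_resHom (hVU : V ≤ U) (hWV : W ≤ V) (F : Submodule ℂ (Hol U)) :
    (F.map (resHom hVU).toLinearMap).map (resHom hWV).toLinearMap =
      F.map (resHom (hWV.trans hVU)).toLinearMap := by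
  rw [← Submodule.map_comp]
  congr 1
  refine LinearMap.ext fun f => Hol.ext fun z => ?_
  simp only [LinearMap.comp_apply, AlgHom.toLinearMap_apply, resHom_apply, res_apply]

/-- Restriction of the coefficients of an even operator. -/
def resCoeffs (hVU : V ≤ U) : Coeffs U →ₗ[ℂ] Coeffs V :=
  (resHom hVU).toLinearMap.prodMap ((resHom hVU).toLinearMap.prodMap (resHom hVU).toLinearMap)

theorem resCoeffs_coeffsLie (hVU : V ≤ U) (s t : Coeffs U) :
    resCoeffs hVU (coeffsLie s t) = coeffsLie (resCoeffs hVU s) (resCoeffs hVU t) := by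
  refine Prod.ext ?_ (Prod.ext ?_ ?_) <;>
  simp only [resCoeffs, coeffsLie, LinearMap.prodMap_apply, AlgHom.toLinearMap_apply, dz_apply,
    Prod.smul_fst, Prod.smul_snd, Prod.fst_sub, Prod.snd_sub, smul_eq_mul, map_sub, map_mul,
    ddz_resHom]

end Restriction

section ChangeOfVariable

theorem Transf.ddz_comp (Φ : Transf V W) (u : Hol W) :
    ddz V (Φ.comp u) = ddz V Φ.φ * Φ.comp (ddz W u) :=
  ddz_eq_of_hasDerivAt (F := ext0 u.1 ∘ ext0 Φ.φ.1)
    (fun z => by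
      rw [Function.comp_apply, ext0_apply]
      exact (ext0_apply u.1 ⟨Φ.φ.1 z, Φ.mapsTo z⟩).symm)
    fun z => by
      rw [mul_comm]
      refine HasDerivAt.comp (z : ℂ) ?_ (hasDerivAt_ext0 Φ.φ z)
      rw [ext0_apply]
      exact hasDerivAt_ext0 u ⟨Φ.φ.1 z, Φ.mapsTo z⟩

/-- Composition with the change of variable, as a homomorphism of algebras. -/
def Transf.compHom (Φ : Transf V W) : Hol W →ₐ[ℂ] Hol V where
  toFun := Φ.comp
  map_one' := rfl
  map_mul' _ _ := rfl
  map_zero' := rfl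
  map_add' _ _ := rfl
  commutes' _ := rfl

theorem Transf.compHom_injective (Φ : Transf V W) : Function.Injective Φ.compHom :=
  fun u v h => Hol.ext fun w => by
    obtain ⟨z, rfl⟩ := Φ.bijective.2 w
    exact congrFun (congrArg Subtype.val h) z

theorem Transf.compHom_surjective (Φ : Transf V W) : Function.Surjective Φ.compHom := by
  intro u
  obtain ⟨ψ, hψ, -⟩ := Function.bijective_iff_has_inverse.1 Φ.bijective
  refine ⟨⟨fun w => u.1 (ψ w), fun w hw => ?_⟩, Hol.ext fun z => congrArg u.1 (hψ z)⟩
  obtain ⟨z, hz⟩ := Φ.bijective.2 ⟨w, hw⟩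
  obtain rfl : ext0 Φ.φ.1 z = w := (ext0_apply Φ.φ.1 z).trans (congrArg Subtype.val hz)
  rw [← analyticAt_comp_iff_of_deriv_ne_zero (Φ.φ.2 z z.2) (Φ.deriv_ne z)]
  refine (u.2 z z.2).congr ((ext0_eventuallyEq u.1 _ (fun y => ?_) z).symm)
  have hy := ext0_apply (fun w : W => u.1 (ψ w)) ⟨Φ.φ.1 y, Φ.mapsTo y⟩
  rw [Function.comp_apply, ext0_apply, hy]
  exact (congrArg u.1 (hψ y)).symm

/-- Composition with the change of variable, as an isomorphism of algebras. -/
def Transf.compEquiv (Φ : Transf V W) : Hol W ≃ₐ[ℂ] Hol V :=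
  AlgEquiv.ofBijective Φ.compHom ⟨Φ.compHom_injective, Φ.compHom_surjective⟩

theorem Transf.compEquiv_mon_one (Φ : Transf V W) : Φ.compEquiv (mon W 1) = Φ.φ :=
  Hol.ext fun _ => pow_one _

theorem Transf.ddz_compEquiv (Φ : Transf V W) (u : Hol W) :
    ddz V (Φ.compEquiv u) = ddz V Φ.φ * Φ.compEquiv (ddz W u) := Φ.ddz_comp u

/-- The component of the vector field `f ∂_z` in the new variable: `f ∂_z = (φ' f) ∂_φ`. -/
def Transf.mapVectorField (Φ : Transf V W) : Hol V →ₗ[ℂ] Hol W :=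
  Φ.compEquiv.toLinearEquiv.symm.toLinearMap ∘ₗ LinearMap.mulLeft ℂ (ddz V Φ.φ)

theorem Transf.mapVectorField_apply (Φ : Transf V W) (f : Hol V) :
    Φ.mapVectorField f = Φ.compEquiv.symm (ddz V Φ.φ * f) := rfl

theorem Transf.compEquiv_symm_mul_ddz (Φ : Transf V W) (f u : Hol V) :
    Φ.compEquiv.symm (f * ddz V u) = Φ.mapVectorField f * ddz W (Φ.compEquiv.symm u) := by
  rw [AlgEquiv.symm_apply_eq, mapVectorField_apply, map_mul, AlgEquiv.apply_symm_apply,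
    mul_comm _ f, mul_assoc, ← Φ.ddz_compEquiv, AlgEquiv.apply_symm_apply]

theorem Transf.mapVectorField_bracket (Φ : Transf V W) (f g : Hol V) :
    Φ.mapVectorField (f * ddz V g - g * ddz V f) =
      Φ.mapVectorField f * ddz W (Φ.mapVectorField g) -
        Φ.mapVectorField g * ddz W (Φ.mapVectorField f) := by
  obtain ⟨a, ha⟩ : ∃ a, ∀ u, Φ.mapVectorField u = a * Φ.compEquiv.symm u :=
    ⟨Φ.compEquiv.symm (ddz V Φ.φ), map_mul Φ.compEquiv.symm _⟩
  simp only [ha, map_sub, Φ.compEquiv_symm_mul_ddz, Derivation.leibniz, smul_eq_mul]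
  ring

/-- The coefficients of an even operator in the new variable, before any change of the odd variable
or of the gauge. -/
def Transf.mapCoeffs (Φ : Transf V W) : Coeffs V →ₗ[ℂ] Coeffs W :=
  Φ.mapVectorField.prodMap (Φ.compEquiv.toLinearEquiv.symm.toLinearMap.prodMap
    Φ.compEquiv.toLinearEquiv.symm.toLinearMap)

theorem Transf.mapCoeffs_apply (Φ : Transf V W) (t : Coeffs V) :
    Φ.mapCoeffs t =
      (Φ.mapVectorField t.1, Φ.compEquiv.symm t.2.1, Φ.compEquiv.symm t.2.2) := rfl

theorem Transf.mapCoeffs_coeffsLie (Φ : Transf V W) (s t : Coeffs V) :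
    Φ.mapCoeffs (coeffsLie s t) = coeffsLie (Φ.mapCoeffs s) (Φ.mapCoeffs t) := by
  refine Prod.ext (Φ.mapVectorField_bracket s.1 t.1) (Prod.ext ?_ ?_) <;>
  simp only [mapCoeffs_apply, coeffsLie, dz_apply, Prod.smul_fst, Prod.smul_snd, Prod.fst_sub,
    Prod.snd_sub, smul_eq_mul, map_sub, compEquiv_symm_mul_ddz]

/-- The coefficients on `W` of the restrictions to `V` of even operators on `U`. -/
def Transf.transport (Φ : Transf V W) (hVU : V ≤ U) : Coeffs U →ₗ[ℂ] Coeffs W :=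
  Φ.mapCoeffs ∘ₗ resCoeffs hVU

theorem vectorFieldPart_map_transport (Φ : Transf V W) (hVU : V ≤ U)
    (L : Submodule ℂ (Coeffs U)) :
    vectorFieldPart (L.map (Φ.transport hVU)) =
      ((vectorFieldPart L).map (resHom hVU).toLinearMap).map Φ.mapVectorField := by
  simp only [vectorFieldPart, ← Submodule.map_comp]
  rfl

theorem LieClosed.map_transport {L : Submodule ℂ (Coeffs U)} (hL : LieClosed L)
    (Φ : Transf V W) (hVU : V ≤ U) : LieClosed (L.map (Φ.transport hVU)) := by
  rintro _ ⟨s, hs, rfl⟩ _ ⟨t, ht, rfl⟩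
  refine ⟨_, hL s hs t ht, ?_⟩
  simp only [Transf.transport, LinearMap.comp_apply, resCoeffs_coeffsLie, Φ.mapCoeffs_coeffsLie]

end ChangeOfVariable

section OddVariableAndGauge

/-- The change of variable of `Φ`, with the factors `β` and `α` given on the target. -/
def Transf.withFactors (Φ : Transf V W) (β α : (Hol W)ˣ) : Transf V W :=
  { Φ with
    β := Units.map Φ.compHom β
    α := Units.map Φ.compHom α }

/-- The function `α(z)⁻¹ F(z, β(z) θ)`. -/
def rescale (β α : (Hol W)ˣ) (F : SFun W) : SFun W := (↑α⁻¹ * F.1, ↑α⁻¹ * β * F.2)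

theorem rescale_injective (β α : (Hol W)ˣ) : Function.Injective (rescale β α) := fun _ _ h =>
  Prod.ext ((α⁻¹).isUnit.mul_left_cancel (congrArg Prod.fst h))
    ((α⁻¹ * β).isUnit.mul_left_cancel (congrArg Prod.snd h))

theorem Transf.pull_withFactors (Φ : Transf V W) (β α : (Hol W)ˣ) (F : SFun W) :
    (Φ.withFactors β α).pull F = Prod.map Φ.compEquiv Φ.compEquiv (rescale β α F) := rfl

theorem Transf.pull_withFactors_injective (Φ : Transf V W) (β α : (Hol W)ˣ) :
    Function.Injective (Φ.withFactors β α).pull :=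
  (Φ.compEquiv.injective.prodMap Φ.compEquiv.injective).comp (rescale_injective β α)

theorem evenHom_rescale {β α : (Hol W)ˣ} {ξ : SFun W} (hβ : ddz W (β : Hol W) = ξ.1 * β)
    (hα : ddz W (α : Hol W) = -ξ.2 * α) (t : Coeffs W) (F : SFun W) :
    evenHom W t (rescale β α F) = rescale β α (evenHom W (gauge ξ t) F) := by
  have hα' : ddz W (↑α⁻¹ : Hol W) = ξ.2 * ↑α⁻¹ := by
    rw [Derivation.leibniz_of_mul_eq_one _ α.inv_mul, smul_eq_mul, hα]
    linear_combination ξ.2 * ↑α⁻¹ * α.inv_mul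
  refine Prod.ext ?_ ?_ <;>
  · simp only [rescale, evenHom_apply, evenOp_apply, gauge_apply, Prod.fst_add, Prod.snd_add,
      Prod.smul_fst, Prod.smul_snd, smul_eq_mul, Derivation.leibniz, hβ, hα']
    ring

theorem Transf.evenHom_prodMap_compEquiv (Φ : Transf V W) (t : Coeffs V) (F : SFun W) :
    evenHom V t (Prod.map Φ.compEquiv Φ.compEquiv F) =
      Prod.map Φ.compEquiv Φ.compEquiv (evenHom W (Φ.mapCoeffs t) F) := by
  refine Prod.ext ?_ ?_ <;>
  · simp only [Prod.map_apply', evenHom_apply, evenOp_apply, mapCoeffs_apply, mapVectorField_apply,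
      Φ.ddz_compEquiv, map_add, map_mul, AlgEquiv.apply_symm_apply]
    ring

theorem Transf.carries_withFactors_iff (Φ : Transf V W) {β α : (Hol W)ˣ} {ξ : SFun W}
    (hβ : ddz W (β : Hol W) = ξ.1 * β) (hα : ddz W (α : Hol W) = -ξ.2 * α) (t : Coeffs V)
    (T : Module.End ℂ (SFun W)) :
    (Φ.withFactors β α).Carries (evenHom V t) T ↔ T = evenHom W (gauge ξ (Φ.mapCoeffs t)) := by
  have hcarries : (Φ.withFactors β α).Carries (evenHom V t)
      (evenHom W (gauge ξ (Φ.mapCoeffs t))) := fun F => by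
    rw [pull_withFactors, pull_withFactors, ← evenHom_rescale hβ hα, Φ.evenHom_prodMap_compEquiv]
  refine ⟨fun hT => LinearMap.ext fun F => ?_, fun hT => hT ▸ hcarries⟩
  exact Φ.pull_withFactors_injective β α ((hT F).trans (hcarries F).symm)

variable (l : LieSubalgebra ℂ (Module.End ℂ (SFun U)))

/-- The coefficients of the even operators belonging to `l`. -/
def coeffsOf : Submodule ℂ (Coeffs U) := l.toSubmodule.comap (evenHom U)

theorem lieClosed_coeffsOf : LieClosed (coeffsOf l) := fun s hs t ht => by
  rw [coeffsOf, Submodule.mem_comap, ← lie_evenHom]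
  exact l.lie_mem hs ht

instance [FiniteDimensional ℂ l] : FiniteDimensional ℂ (coeffsOf l) :=
  haveI : FiniteDimensional ℂ l.toSubmodule := ‹FiniteDimensional ℂ l›
  finiteDimensional_comap (evenHom_injective U) l.toSubmodule

theorem Transf.carriesAlgebra_withFactors (Φ : Transf V W) (hVU : V ≤ U) {β α : (Hol W)ˣ}
    {ξ : SFun W} (hβ : ddz W (β : Hol W) = ξ.1 * β) (hα : ddz W (α : Hol W) = -ξ.2 * α) :
    (Φ.withFactors β α).CarriesAlgebra hVU l
      ((((coeffsOf l).map (Φ.transport hVU)).map (gauge ξ)).map (evenHom W)) := by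
  have hcarries := fun t : Coeffs U =>
    Φ.carries_withFactors_iff hβ hα (resCoeffs hVU t)
  intro T
  constructor
  · rintro ⟨_, ⟨_, ⟨t, ht, rfl⟩, rfl⟩, rfl⟩
    exact ⟨t.1, t.2.1, t.2.2, ht, (hcarries t _).2 rfl⟩
  · rintro ⟨f, g, h, ht, hT⟩
    exact ⟨_, ⟨_, ⟨(f, g, h), ht, rfl⟩, rfl⟩, ((hcarries (f, g, h) T).1 hT).symm⟩

end OddVariableAndGauge

/-! ### Coordinates adapted to a Lie algebra of vector fields -/

section AdaptedCoordinates

theorem exists_isOpen_bijOn_ball {𝕜 : Type*} [NontriviallyNormedField 𝕜] [CompleteSpace 𝕜]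
    {F : 𝕜 → 𝕜} {F' p : 𝕜} (hF : HasStrictDerivAt F F' p) (hF' : F' ≠ 0) {N : Set 𝕜}
    (hN : IsOpen N) (hp : p ∈ N) (hcont : ContinuousOn F N) :
    ∃ V ⊆ N, IsOpen V ∧ p ∈ V ∧ ∃ r > 0, Set.BijOn F V (Metric.ball (F p) r) := by
  have hFp := hF.hasStrictFDerivAt_equiv hF'
  set e := hFp.toOpenPartialHomeomorph F
  have hpe : p ∈ e.source := hFp.mem_toOpenPartialHomeomorph_source
  have hS : IsOpen (e.source ∩ N) := e.open_source.inter hN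
  have himage : F '' (e.source ∩ N) ∈ nhds (F p) := by
    rw [← hF.map_nhds_eq hF']
    exact Filter.image_mem_map (hS.mem_nhds ⟨hpe, hp⟩)
  obtain ⟨r, hr, hball⟩ := Metric.mem_nhds_iff.1 himage
  refine ⟨(e.source ∩ N) ∩ F ⁻¹' Metric.ball (F p) r, fun z hz => hz.1.2,
    (hcont.mono Set.inter_subset_right).isOpen_inter_preimage hS Metric.isOpen_ball,
    ⟨⟨hpe, hp⟩, Metric.mem_ball_self hr⟩, r, hr, fun z hz => hz.2,
    e.injOn.mono fun z hz => hz.1.1, fun w hw => ?_⟩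
  obtain ⟨z, hz, rfl⟩ := hball hw
  exact ⟨z, ⟨hz, hw⟩, rfl⟩

theorem isOpen_inter_preimage_ext0_compl_zero (f : Hol U) :
    IsOpen ((U : Set ℂ) ∩ ext0 f.1 ⁻¹' {0}ᶜ) :=
  AnalyticOnNhd.continuousOn f.2 |>.isOpen_inter_preimage U.isOpen isOpen_compl_singleton

theorem exists_transf_φ_eq_resHom (φ : Hol U) (p : U) (hp : (ddz U φ).1 p ≠ 0) :
    ∃ (V W : Opens ℂ) (hVU : V ≤ U) (Φ : Transf V W),
      (p : ℂ) ∈ V ∧ IsDisc W ∧ Φ.φ = resHom hVU φ := by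
  obtain ⟨V, hVN, hV, hpV, r, hr, hbij⟩ := exists_isOpen_bijOn_ball
    (φ.2 p p.2).hasStrictDerivAt hp (isOpen_inter_preimage_ext0_compl_zero (ddz U φ))
    ⟨p.2, by rwa [Set.mem_preimage, ext0_apply]⟩
    ((AnalyticOnNhd.continuousOn φ.2).mono Set.inter_subset_left)
  have hVU : (⟨V, hV⟩ : Opens ℂ) ≤ U := fun z hz => (hVN hz).1
  refine ⟨⟨V, hV⟩, ⟨Metric.ball _ r, Metric.isOpen_ball⟩, hVU,
    { φ := resHom hVU φ, mapsTo := fun z => hbij.mapsTo z.2, bijective := hbij.bijective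
      deriv_ne := fun z => ?_, β := 1, α := 1 }, hpV, ⟨_, r, hr, rfl⟩, rfl⟩
  rw [ddz_resHom, resHom_apply]
  exact (hVN z.2).2

theorem Transf.mapVectorField_resHom_of_φ_eq {hVU : V ≤ U} {φ f : Hol U} (Φ : Transf V W)
    (hΦ : Φ.φ = resHom hVU φ) (hφ : ddz U φ * f = 1) (g : Hol U) :
    Φ.mapVectorField (resHom hVU (g * f)) = Φ.compEquiv.symm (resHom hVU g) := by
  rw [mapVectorField_apply, hΦ, ddz_resHom, ← map_mul, mul_left_comm, hφ, mul_one]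

/-- A space of vector fields `f ∂_z` containing `∂_z`, and also `z ∂_z` unless `∂_z` spans it. -/
def IsStraightened (F : Submodule ℂ (Hol W)) : Prop :=
  1 ∈ F ∧ (F ≤ Submodule.span ℂ {1} ∨ mon W 1 ∈ F)

theorem exists_transf_isStraightened_of_isUnit (hU : IsPreconnected (U : Set ℂ))
    (hprim : HasPrimitives U) {F : Submodule ℂ (Hol U)} [FiniteDimensional ℂ F]
    (hF : ∀ f ∈ F, ∀ g ∈ F, f * ddz U g - g * ddz U f ∈ F) {u : (Hol U)ˣ} (hu : (u : Hol U) ∈ F)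
    (p : U) :
    ∃ (V W : Opens ℂ) (hVU : V ≤ U) (Φ : Transf V W), (p : ℂ) ∈ V ∧ IsDisc W ∧
      IsStraightened ((F.map (resHom hVU).toLinearMap).map Φ.mapVectorField) := by
  obtain ⟨φ, f, hf, hφ, hcase⟩ := exists_straightening hU hprim hF hu
  obtain ⟨V, W, hVU, Φ, hpV, hW, hΦ⟩ :=
    exists_transf_φ_eq_resHom φ p (apply_ne_zero_of_isUnit (IsUnit.of_mul_eq_one f hφ) p)
  have hmap := Φ.mapVectorField_resHom_of_φ_eq hΦ hφ
  have hone : Φ.mapVectorField (resHom hVU f) = 1 := by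
    rw [← one_mul f, hmap, map_one, map_one]
  refine ⟨V, W, hVU, Φ, hpV, hW, ⟨_, ⟨f, hf, rfl⟩, hone⟩, hcase.imp (fun hle => ?_) fun hmem => ?_⟩
  · refine (Submodule.map_mono (Submodule.map_mono hle)).trans_eq ?_
    rw [Submodule.map_span, Submodule.map_span, Set.image_singleton, Set.image_singleton,
      AlgHom.toLinearMap_apply, hone]
  · refine ⟨_, ⟨φ * f, hmem, rfl⟩, ?_⟩
    rw [AlgHom.toLinearMap_apply, hmap, ← hΦ, ← Φ.compEquiv_mon_one, AlgEquiv.symm_apply_apply]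

theorem exists_transf_isStraightened {F : Submodule ℂ (Hol U)} [FiniteDimensional ℂ F]
    (hF : ∀ f ∈ F, ∀ g ∈ F, f * ddz U g - g * ddz U f ∈ F) {f₀ : Hol U} (h₀ : f₀ ∈ F) (p : U)
    (hp : f₀.1 p ≠ 0) :
    ∃ (V W : Opens ℂ) (hVU : V ≤ U) (Φ : Transf V W), (p : ℂ) ∈ V ∧ IsDisc W ∧
      IsStraightened ((F.map (resHom hVU).toLinearMap).map Φ.mapVectorField) := by
  obtain ⟨ρ, hρ, hball⟩ := Metric.isOpen_iff.1 (isOpen_inter_preimage_ext0_compl_zero f₀) p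
    ⟨p.2, by rwa [Set.mem_preimage, ext0_apply]⟩
  set B : Opens ℂ := ⟨Metric.ball p ρ, Metric.isOpen_ball⟩
  have hB : IsDisc B := ⟨p, ρ, hρ, rfl⟩
  have hBU : B ≤ U := fun z hz => (hball hz).1
  obtain ⟨u, hu⟩ : IsUnit (resHom hBU f₀) := isUnit_of_forall_ne_zero fun z => (hball z.2).2
  have hFB : ∀ f ∈ F.map (resHom hBU).toLinearMap, ∀ g ∈ F.map (resHom hBU).toLinearMap,
      f * ddz B g - g * ddz B f ∈ F.map (resHom hBU).toLinearMap := by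
    rintro _ ⟨f, hf, rfl⟩ _ ⟨g, hg, rfl⟩
    exact ⟨_, hF f hf g hg, by simp only [AlgHom.toLinearMap_apply, map_sub, map_mul, ddz_resHom]⟩
  obtain ⟨V, W, hVB, Φ, hpV, hW, hΦ⟩ := exists_transf_isStraightened_of_isUnit
    hB.isConnected.isPreconnected hB.hasPrimitives hFB (u := u) (hu ▸ ⟨f₀, h₀, rfl⟩)
    ⟨p, Metric.mem_ball_self hρ⟩
  rw [map_resHom_map_resHom] at hΦ
  exact ⟨V, W, hVB.trans hBU, Φ, hpV, hW, hΦ⟩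

end AdaptedCoordinates

/-! ### The classification -/

section Classification

theorem Hol.dense_setOf_apply_ne_zero (hU : IsPreconnected (U : Set ℂ)) {f : Hol U} (hf : f ≠ 0) :
    Dense {p : U | f.1 p ≠ 0} := by
  rw [dense_iff_inter_open]
  rintro O hO ⟨q, hq⟩
  by_contra! hempty
  refine hf (Hol.ext fun z => ?_)
  have hzero : ext0 f.1 =ᶠ[nhds (q : ℂ)] 0 := by
    rw [← U.isOpenEmbedding'.map_nhds_eq q]
    refine Filter.eventually_map.2 ?_
    filter_upwards [hO.mem_nhds hq] with z hz
    by_contra hfz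
    exact hempty.subset ⟨hz, fun h => hfz ((ext0_apply f.1 z).trans h)⟩
  have hz := f.2.eqOn_zero_of_preconnected_of_eventuallyEq_zero hU q.2 hzero z.2
  rwa [ext0_apply] at hz

variable {l : LieSubalgebra ℂ (Module.End ℂ (SFun U))} {p : U}

theorem mem_vectorFieldPart_coeffsOf {f : Hol U} :
    f ∈ vectorFieldPart (coeffsOf l) ↔ ∃ g h, evenOp f g h ∈ l :=
  mem_vectorFieldPart.trans Prod.exists

theorem isRegularPoint_iff : IsRegularPoint l p ↔
    vectorFieldPart (coeffsOf l) = ⊥ ∨ ∃ f ∈ vectorFieldPart (coeffsOf l), f.1 p ≠ 0 := by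
  simp only [IsRegularPoint, Submodule.eq_bot_iff, mem_vectorFieldPart_coeffsOf,
    forall_exists_index, exists_and_right]

theorem dense_isRegularPoint (hU : IsPreconnected (U : Set ℂ))
    (l : LieSubalgebra ℂ (Module.End ℂ (SFun U))) : Dense {p : U | IsRegularPoint l p} := by
  simp only [isRegularPoint_iff]
  by_cases hbot : vectorFieldPart (coeffsOf l) = ⊥
  · simp [hbot]
  · obtain ⟨f, hfl, hf⟩ := Submodule.exists_mem_ne_zero_of_ne_bot hbot
    exact (Hol.dense_setOf_apply_ne_zero hU hf).mono fun p hp => Or.inr ⟨f, hfl, hp⟩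

theorem isForm0_of_forall {N : Submodule ℂ (Module.End ℂ (SFun W))} [FiniteDimensional ℂ N]
    (hN : ∀ T ∈ N, ∃ g h : Hol W, T = aOp g h) : IsForm0 N := by
  let b := Module.finBasis ℂ N
  choose g h hgh using fun i => hN _ (b i).2
  have hb : (fun i => aOp (g i) (h i)) = N.subtype ∘ b := funext fun i => (hgh i).symm
  refine ⟨Module.finrank ℂ N, g, h, ?_, ?_⟩
  · rw [hb]
    exact b.linearIndependent.map' N.subtype N.ker_subtype
  · rw [hb, Set.range_comp, ← Submodule.map_span, b.span_eq, Submodule.map_top,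
      Submodule.range_subtype]

theorem isForm0_map_evenHom {L : Submodule ℂ (Coeffs W)} [FiniteDimensional ℂ L]
    (hL : vectorFieldPart L = ⊥) : IsForm0 (L.map (evenHom W)) := by
  refine isForm0_of_forall ?_
  rintro _ ⟨⟨f, x⟩, hx, rfl⟩
  obtain rfl : f = 0 := (Submodule.eq_bot_iff _).1 hL f (mem_vectorFieldPart.2 ⟨x, hx⟩)
  exact ⟨x.1, x.2, rfl⟩

/-- The identity change of variable. -/
def Transf.id (U : Opens ℂ) : Transf U U where
  φ := mon U 1
  mapsTo z := by simp [mon_apply]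
  bijective := by
    convert Function.bijective_id using 2 with z
    exact Subtype.ext (pow_one _)
  deriv_ne z := by
    rw [ddz_mon_one]
    exact one_ne_zero
  β := 1
  α := 1

theorem exists_carriesAlgebra_isForm0 [FiniteDimensional ℂ l]
    (hl : vectorFieldPart (coeffsOf l) = ⊥) :
    ∃ (Φ : Transf U U) (N : Submodule ℂ (Module.End ℂ (SFun U))),
      Φ.CarriesAlgebra le_rfl l N ∧ IsForm0 N :=
  ⟨_, _, (Transf.id U).carriesAlgebra_withFactors l le_rfl (β := 1) (α := 1) (ξ := 0)
      (by simp) (by simp), isForm0_map_evenHom (by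
      rw [vectorFieldPart_map_gauge, vectorFieldPart_map_transport, hl, Submodule.map_bot,
        Submodule.map_bot])⟩

theorem exists_unit_ddz_eq (hU : HasPrimitives U) (ξ : Hol U) :
    ∃ β : (Hol U)ˣ, ddz U (β : Hol U) = ξ * β := by
  obtain ⟨ψ, hψ⟩ := hU ξ
  obtain ⟨β, hβ⟩ := isUnit_exp ψ
  exact ⟨β, by rw [hβ, ddz_exp, hψ, mul_comm]⟩

theorem exists_carriesAlgebra_isForm [FiniteDimensional ℂ l] {f : Hol U}
    (hf : f ∈ vectorFieldPart (coeffsOf l)) (hfp : f.1 p ≠ 0) :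
    ∃ (V W : Opens ℂ) (hVU : V ≤ U) (Φ : Transf V W)
      (N : Submodule ℂ (Module.End ℂ (SFun W))),
      (p : ℂ) ∈ V ∧ Φ.CarriesAlgebra hVU l N ∧ (IsForm1 N ∨ IsForm2 N ∨ IsForm3 N) := by
  have hL := lieClosed_coeffsOf l
  obtain ⟨V, W, hVU, Φ, hpV, hW, hone, hcase⟩ :=
    exists_transf_isStraightened hL.mul_ddz_sub_mem hf p hfp
  rw [← vectorFieldPart_map_transport] at hone hcase
  obtain ⟨ξ, hform⟩ := exists_gauge_isForm hW.isConnected (hL.map_transport Φ hVU) hone hcase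
  obtain ⟨β, hβ⟩ := exists_unit_ddz_eq hW.hasPrimitives ξ.1
  obtain ⟨α, hα⟩ := exists_unit_ddz_eq hW.hasPrimitives (-ξ.2)
  exact ⟨V, W, hVU, _, _, hpV, Φ.carriesAlgebra_withFactors l hVU hβ hα, hform⟩

end Classification

end EvenOps

end

open EvenOps

theorem mainTheorem1 (U : TopologicalSpace.Opens ℂ) (hU : IsConnected (U : Set ℂ))
    (l : LieSubalgebra ℂ (Module.End ℂ (EvenOps.SFun U))) (hl : l ≤ EvenOps.d10 U)
    (hfin : FiniteDimensional ℂ l) :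
    Dense {p : U | EvenOps.IsRegularPoint l p} ∧
    ∀ p : U, EvenOps.IsRegularPoint l p →
      ∃ (V W : TopologicalSpace.Opens ℂ) (hVU : V ≤ U) (Φ : EvenOps.Transf V W)
        (N : Submodule ℂ (Module.End ℂ (EvenOps.SFun W))),
        (p : ℂ) ∈ V ∧ Φ.CarriesAlgebra hVU l N ∧
        (EvenOps.IsForm0 N ∨ EvenOps.IsForm1 N ∨ EvenOps.IsForm2 N ∨ EvenOps.IsForm3 N) := by
  refine ⟨dense_isRegularPoint hU.isPreconnected l, fun p hp => ?_⟩
  rcases isRegularPoint_iff.1 hp with hzero | ⟨f, hf, hfp⟩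
  · obtain ⟨Φ, N, hΦ, hN⟩ := exists_carriesAlgebra_isForm0 hzero
    exact ⟨U, U, le_rfl, Φ, N, p.2, hΦ, Or.inl hN⟩
  · obtain ⟨V, W, hVU, Φ, N, hpV, hΦ, hN⟩ := exists_carriesAlgebra_isForm hf hfp
    exact ⟨V, W, hVU, Φ, N, hpV, hΦ, Or.inr hN⟩
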